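/- Let $K$ be a field, $n\ge 1$, $r\ge 1$, and let $Q$ be the cyclic quiver with vertices $1,\dots,n$ (indices are read modulo $n$) and one arrow $\alpha_v\colon v\to v+1$ for every vertex $v$. Consider an irredundant system of relations $$\alpha_{k_{2i}}\cdots\alpha_{k_{2i-1}+1}\alpha_{k_{2i-1}}=0\qquad(1\le i\le r),$$ where each path on the left has at least two arrows (it may run around the cycle several times), $k_1<k_3<\dots<k_{2r-1}<k_1$ is cyclically ordered (in particular these $r$ indices are distinct), and irredundant means that no relation lies in the two-sided ideal generated by the others. Let $\Lambda=KQ/I$ be the cyclic Nakayama algebra given by these relations, where $I$ is the two-sided ideal that they generate. Modules are left modules, and paths are composed from right to left, so that the indecomposable projective $P_v=\Lambda e_v$ has top $S_v$. Let $\operatorname{findim}\Lambda$ be the supremum of $\operatorname{pd}M$ over all finitely generated $\Lambda$-modules $M$ of finite projective dimension. For vertices $a,b$ let $M(a,b)$ be the uniserial $\Lambda$-module with composition factors $S_{a+1},S_{a+2},\dots,S_b$, from the top to the socle, where the list of consecutive vertices stops the first time it reaches $b$ (so it has $n$ terms if $a=b$). Put, up to isomorphism and with cyclically read indices $k_{2r+1}=k_1$,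 $k_{2r+2}=k_2$, $$\mathcal B(\Lambda)=\{M(k_{2j},k_{2j+2}) : 1\le j\le r\},\qquad \nabla(\Lambda)=\{M(k_{2j-1},k_{2j+1}) : 1\le j\le r\}.$$ (a) If $\Lambda$ is not self-injective, then the following are equivalent: 1. $\operatorname{findim}\Lambda=1$; 2. $\{k_1,k_3,\dots,k_{2r-1}\}=\{k_2,k_4,\dots,k_{2r}\}$; 3. $\mathcal B(\Lambda)=\nabla(\Lambda)$. (b) Whether or not $\Lambda$ is self-injective, $\operatorname{findim}\Lambda=1$ if and only if $\operatorname{findim}\Lambda^{\mathrm{op}}=1$. -/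

import Mathlib

open CategoryTheory

universe u

/-- A path in the cyclic quiver with vertex set `ZMod n` and one arrow `α_v : v ⟶ v + 1` for every
vertex `v`.  It is determined by its source and its number of arrows: `⟨v, l⟩` is the path
`α_{v+l-1} ⋯ α_{v+1} α_v`, and `⟨v, 0⟩` is the trivial path at `v`. -/
@[ext]
structure CyclicPath (n : ℕ) where
  source : ZMod n
  length : ℕ

/-- The end point of a path. -/
def CyclicPath.target {n : ℕ} (p : CyclicPath n) : ZMod n := p.source + p.length

/-- The path "first `q`, then `p`" (meaningful if `q` ends where `p` starts). -/
def CyclicPath.comp {n : ℕ} (p q : CyclicPath n) : CyclicPath n :=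
  ⟨q.source, q.length + p.length⟩

/-- The path algebra `KQ` of the cyclic quiver `Q` with vertex set `ZMod n`: the `K`-vector space
with basis the paths of `Q`, multiplied by concatenation. -/
def CyclicPathAlgebra (K : Type u) [Field K] (n : ℕ) : Type u := CyclicPath n →₀ K

namespace CyclicPathAlgebra

noncomputable section

variable {K : Type u} [Field K] {n : ℕ}

instance : AddCommGroup (CyclicPathAlgebra K n) :=
  inferInstanceAs (AddCommGroup (CyclicPath n →₀ K))

instance : Module K (CyclicPathAlgebra K n) :=
  inferInstanceAs (Module K (CyclicPath n →₀ K))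

variable (K) in
/-- A path, as an element of the path algebra. -/
def path (p : CyclicPath n) : CyclicPathAlgebra K n := Finsupp.single p (1 : K)

open scoped Classical in
/-- The product of two paths: `p * q` is "first `q`, then `p`" if `q` ends where `p` starts,
and `0` otherwise. -/
def pathMul (p q : CyclicPath n) : CyclicPathAlgebra K n :=
  if p.source = q.target then path K (p.comp q) else 0

/-- The bilinear extension of the product of paths. -/
def mulHom : CyclicPathAlgebra K n →ₗ[K] CyclicPathAlgebra K n →ₗ[K] CyclicPathAlgebra K n :=
  Finsupp.linearCombination K fun p : CyclicPath n =>
    (Finsupp.linearCombination K fun q : CyclicPath n => (pathMul p q : CyclicPathAlgebra K n) :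
      CyclicPathAlgebra K n →ₗ[K] CyclicPathAlgebra K n)

instance : Mul (CyclicPathAlgebra K n) := ⟨fun x y => mulHom x y⟩

instance [NeZero n] : One (CyclicPathAlgebra K n) := ⟨∑ v : ZMod n, path K ⟨v, 0⟩⟩

theorem mul_eq (x y : CyclicPathAlgebra K n) : x * y = mulHom x y := rfl

theorem one_eq [NeZero n] : (1 : CyclicPathAlgebra K n) = ∑ v : ZMod n, path K ⟨v, 0⟩ := rfl

theorem path_mul_path (p q : CyclicPath n) : path K p * path K q = pathMul p q := by
  rw [mul_eq, mulHom, path, path]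
  erw [Finsupp.linearCombination_single, one_smul, Finsupp.linearCombination_single, one_smul]

theorem induction {P : CyclicPathAlgebra K n → Prop} (x : CyclicPathAlgebra K n)
    (h0 : P 0) (hadd : ∀ x y, P x → P y → P (x + y))
    (hpath : ∀ (c : K) (p : CyclicPath n), P (c • path K p)) : P x := by
  refine Finsupp.induction_linear (motive := P) x h0 hadd fun p c => ?_
  have h := hpath c p
  have e : c • path K p = (Finsupp.single p c : CyclicPath n →₀ K) := by
    rw [path]
    exact (Finsupp.smul_single c p (1 : K)).trans (by rw [smul_eq_mul, mul_one])
  rwa [e] at h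

theorem left_distrib' (x y z : CyclicPathAlgebra K n) : x * (y + z) = x * y + x * z := by
  simp only [mul_eq, map_add]

theorem right_distrib' (x y z : CyclicPathAlgebra K n) : (x + y) * z = x * z + y * z := by
  simp only [mul_eq, map_add, LinearMap.add_apply]

theorem zero_mul' (x : CyclicPathAlgebra K n) : 0 * x = 0 := by
  simp only [mul_eq, map_zero, LinearMap.zero_apply]

theorem mul_zero' (x : CyclicPathAlgebra K n) : x * 0 = 0 := by
  simp only [mul_eq, map_zero]

theorem smul_mul' (c : K) (x y : CyclicPathAlgebra K n) : (c • x) * y = c • (x * y) := by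
  simp only [mul_eq, map_smul, LinearMap.smul_apply]

theorem mul_smul' (c : K) (x y : CyclicPathAlgebra K n) : x * (c • y) = c • (x * y) := by
  simp only [mul_eq, map_smul]

theorem mul_assoc' (x y z : CyclicPathAlgebra K n) : x * y * z = x * (y * z) := by
  induction x using induction with
  | h0 => simp only [zero_mul']
  | hadd a b ha hb => simp only [right_distrib', ha, hb]
  | hpath c p =>
  induction y using induction with
  | h0 => simp only [zero_mul', mul_zero']
  | hadd a b ha hb => simp only [right_distrib', left_distrib', ha, hb]
  | hpath d q =>
  induction z using induction with
  | h0 => simp only [mul_zero']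
  | hadd a b ha hb => simp only [left_distrib', ha, hb]
  | hpath e r =>
  simp only [smul_mul', mul_smul', path_mul_path]
  congr 3
  unfold pathMul
  by_cases h1 : p.source = q.target <;> by_cases h2 : q.source = r.target
  · have h3 : (p.comp q).source = r.target := h2
    have h4 : p.source = (q.comp r).target := by
      rw [h1]; simp only [CyclicPath.target, CyclicPath.comp] at h2 ⊢; rw [h2]; push_cast; ring
    rw [if_pos h1, if_pos h2, path_mul_path, path_mul_path, pathMul, pathMul, if_pos h3, if_pos h4]
    simp only [CyclicPath.comp, add_assoc]
  · have h3 : ¬ (p.comp q).source = r.target := h2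
    rw [if_pos h1, if_neg h2, path_mul_path, pathMul, if_neg h3, mul_zero']
  · have h4 : ¬ p.source = (q.comp r).target := by
      intro h; apply h1; rw [h]
      simp only [CyclicPath.target, CyclicPath.comp] at h2 ⊢; rw [h2]; push_cast; ring
    rw [if_neg h1, if_pos h2, path_mul_path, pathMul, if_neg h4, zero_mul']
  · rw [if_neg h1, if_neg h2, zero_mul', mul_zero']

theorem one_mul' [NeZero n] (x : CyclicPathAlgebra K n) : 1 * x = x := by
  induction x using induction with
  | h0 => exact mul_zero' 1
  | hadd a b ha hb => rw [left_distrib', ha, hb]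
  | hpath c p =>
  rw [mul_smul']; congr 1
  rw [one_eq, mul_eq, map_sum, LinearMap.sum_apply, Finset.sum_eq_single p.target]
  · rw [← mul_eq, path_mul_path, pathMul, if_pos rfl]; rfl
  · intro v _ hv
    rw [← mul_eq, path_mul_path, pathMul, if_neg hv]
  · intro h; exact absurd (Finset.mem_univ _) h

theorem mul_one' [NeZero n] (x : CyclicPathAlgebra K n) : x * 1 = x := by
  induction x using induction with
  | h0 => exact zero_mul' 1
  | hadd a b ha hb => rw [right_distrib', ha, hb]
  | hpath c p =>
  rw [smul_mul']; congr 1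
  rw [one_eq, mul_eq, map_sum, Finset.sum_eq_single p.source]
  · rw [← mul_eq, path_mul_path, pathMul, if_pos (by simp [CyclicPath.target])]
    simp [CyclicPath.comp]
  · intro v _ hv
    rw [← mul_eq, path_mul_path, pathMul, if_neg (by simpa [CyclicPath.target] using hv.symm)]
  · intro h; exact absurd (Finset.mem_univ _) h

instance [NeZero n] : Ring (CyclicPathAlgebra K n) where
  __ := (inferInstance : AddCommGroup (CyclicPathAlgebra K n))
  left_distrib := left_distrib'
  right_distrib := right_distrib'
  zero_mul := zero_mul'
  mul_zero := mul_zero'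
  mul_assoc := mul_assoc'
  one_mul := one_mul'
  mul_one := mul_one'

instance [NeZero n] : Algebra K (CyclicPathAlgebra K n) :=
  Algebra.ofModule smul_mul' mul_smul'

end

end CyclicPathAlgebra

/-- An irredundant system of `r` zero relations for the cyclic quiver with `n` vertices.  The
relations are numbered by `j : Fin r` (cyclically: `j + 1` wraps around).  The relation number `j`
says that the path `α_{last j} ⋯ α_{first j}` vanishes; so `first` lists the indices
`k₁, k₃, …, k_{2r-1}` and `last` (below) lists `k₂, k₄, …, k_{2r}`.  The end points do not
determine the path (it may run around the cycle), therefore the number `length j` of its arrows is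
part of the data. -/
structure IrredundantSystem (K : Type u) [Field K] (n r : ℕ) [NeZero n] [NeZero r] where
  first : Fin r → ZMod n
  length : Fin r → ℕ
  /-- The relations generate an admissible ideal: each of them lies in the square of the arrow
  ideal. -/
  two_le_length : ∀ j, 2 ≤ length j
  /-- `k₁ < k₃ < ⋯ < k_{2r-1} < k₁` in the cyclic order: these are distinct and, after a rotation
  of the numbering, in increasing order in `{0, …, n - 1}`. -/
  cyclically_ordered : ∃ c : Fin r, StrictMono fun j : Fin r => (first (j + c)).val
  /-- No relation lies in the two-sided ideal generated by the other ones. -/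
  irredundant : ∀ j, CyclicPathAlgebra.path K ⟨first j, length j⟩ ∉
    TwoSidedIdeal.span ((fun i => CyclicPathAlgebra.path K ⟨first i, length i⟩) '' {i | i ≠ j})

namespace IrredundantSystem

noncomputable section

variable {K : Type u} [Field K] {n r : ℕ} [NeZero n] [NeZero r] (S : IrredundantSystem K n r)

/-- The index of the last arrow of the relation number `j`. -/
def last (j : Fin r) : ZMod n := S.first j + S.length j - 1

/-- The two-sided ideal of the path algebra generated by the relations. -/
def relationIdeal : TwoSidedIdeal (CyclicPathAlgebra K n) :=
  TwoSidedIdeal.span (Set.range fun j => CyclicPathAlgebra.path K ⟨S.first j, S.length j⟩)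

/-- The cyclic Nakayama algebra `Λ = KQ / I` given by the system of relations. -/
abbrev Nakayama : Type u := S.relationIdeal.ringCon.Quotient

/-- The residue class of a path in `Λ`. -/
def pathClass (p : CyclicPath n) : S.Nakayama :=
  S.relationIdeal.ringCon.mk' (CyclicPathAlgebra.path K p)

/-- The quotient of the indecomposable projective left module `Λ e_v` by the submodule generated by
the path with source `v` and `d` arrows, written as `Λ ⧸ (Λ (1 - e_v) + Λ p)`.  If `d` is at most
the length of `Λ e_v`, then this is the uniserial left `Λ`-module of length `d` with the composition
factors `S_v, S_{v+1}, …, S_{v+d-1}`, from the top to the socle. -/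
abbrev uniserial (v : ZMod n) (d : ℕ) : Type u :=
  S.Nakayama ⧸ (Ideal.span {1 - S.pathClass ⟨v, 0⟩, S.pathClass ⟨v, d⟩} : Ideal S.Nakayama)

/-- The number of terms of the list `a + 1, a + 2, …, b` of consecutive vertices that stops when it
meets `b` for the first time; it lies between `1` and `n` (it is `n` if `a = b`). -/
def steps (a b : ZMod n) : ℕ := (b - a - 1).val + 1

/-- The uniserial module with the composition factors `S_{a+1}, S_{a+2}, …, S_b`, from the top to
the socle. -/
abbrev interval (a b : ZMod n) : Type u := S.uniserial (a + 1) (steps a b)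

/-- The base set `𝓑(Λ)`, as a class of left `Λ`-modules that is closed under isomorphism: its
members are the modules isomorphic to some `Δ_{j+1}`, which has top `S_{k_{2j}+1}` and socle
`S_{k_{2j+2}}`. -/
def baseSet : Set (ModuleCat.{u} S.Nakayama) :=
  {M | ∃ j : Fin r,
    Nonempty (M ≃ₗ[S.Nakayama] S.interval (S.last j) (S.last (j + 1)))}

/-- The set `∇(Λ)`, as a class of left `Λ`-modules that is closed under isomorphism: its members are
the modules isomorphic to some `∇_j`, which has top `S_{k_{2j-1}+1}` and socle `S_{k_{2j+1}}`. -/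
def nablaSet : Set (ModuleCat.{u} S.Nakayama) :=
  {M | ∃ j : Fin r,
    Nonempty (M ≃ₗ[S.Nakayama] S.interval (S.first j) (S.first (j + 1)))}

end

end IrredundantSystem

/-- The (little, left) finitistic dimension of a ring: the supremum of the projective dimensions of
the finitely generated left modules of finite projective dimension. -/
noncomputable def findim (R : Type u) [Ring R] : WithBot ℕ∞ :=
  sSup {d | ∃ M : ModuleCat.{u} R, Module.Finite R M ∧
    projectiveDimension M ≠ ⊤ ∧ d = projectiveDimension M}

/-- A ring is self-injective if it is injective as a left module over itself. -/
def SelfInjective (R : Type u) [Ring R] : Prop := Module.Injective R R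

/-! Write F and L for the sets of first and last arrows of the minimal zero paths (`firstArrows`,
`lastArrows`). The core is `findim_eq_one_iff`: the finitistic dimension is 1 exactly when L ⊆ F and
F is not the whole vertex set.

Upper bound: let 0 → P → Q → M → 0 be exact with P and Q projective. If S_v embeds in M only for v ∈
F, then P → Q stays injective modulo radicals, so it splits and M is projective
(`projective_of_exact`). The socle of a free module involves only S_v with v ∈ L. Hence, if L ⊆ F,
every first syzygy satisfies the condition on M, and induction brings any finite projective
dimension down to at most 1. If F is everything, it even drops to 0.

Lower bound: for v ∉ F, right multiplication by α_v identifies Λe_{v+1} with Λα_v, and Λ/Λα_v has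
projective dimension 1. If moreover v ∈ L, some nonzero path p ending at v is killed by α_v; then Λp
is S_v and Λ/Λp has projective dimension 2.

Irredundance makes F and L equinumerous (`last_injective`), so L ⊆ F means L = F, a condition
invariant under reversing arrows; this is (b). For (a), F = everything forces projectives of equal
length and thus self-injectivity, which the hypothesis excludes. Finally, the last arrows go around
the cycle in the same order as the first ones (`steps_last_succ_le`), so L = F matches the two sets
of modules; conversely, the tops of these modules recover L and F.

The homological part uses only a basis of paths, a notion stable under passing to the opposite
algebra. -/

/-- A multiplicative basis of paths for an algebra `R` of the same shape as a quotient of the path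
algebra of the cyclic quiver by zero relations: `path v l` is the residue class of the path with
source `v` and `l` arrows.  The nonzero paths form a basis; `coeff v l` reads off the coefficient of
such a path. -/
structure PathBasis (K R : Type*) [Field K] [Ring R] [Algebra K R] (n : ℕ) [NeZero n] where
  path : ZMod n → ℕ → R
  path_mul_path : ∀ v l w m, path v l * path w m = if v = w + m then path w (m + l) else 0
  sum_path_zero : ∑ v, path v 0 = 1
  exists_path_eq_zero : ∃ N, ∀ v l, N ≤ l → path v l = 0
  path_one_ne_zero : ∀ v, path v 1 ≠ 0
  coeff : ZMod n → ℕ → R →ₗ[K] K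
  coeff_path : ∀ v l w m, path v l ≠ 0 → coeff v l (path w m) = if w = v ∧ m = l then 1 else 0
  span_eq_top : Submodule.span K (Set.range fun p : ZMod n × ℕ => path p.1 p.2) = ⊤

namespace PathBasis

variable {K R : Type*} [Field K] [Ring R] [Algebra K R] {n : ℕ} [NeZero n] (B : PathBasis K R n)

/-- The induced basis of the opposite algebra; the arrow `v ⟶ v + 1` becomes an arrow
`-v - 1 ⟶ -v`. -/
def op : PathBasis K Rᵐᵒᵖ n where
  -- This is the path of length `l` that ends at `-v`: reversal makes the end the source, and the
  -- sign restores arrows of the form `v ⟶ v + 1`.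
  path v l := MulOpposite.op (B.path (-v - l) l)
  path_mul_path v l w m := by
    rw [← MulOpposite.op_mul, B.path_mul_path]
    by_cases h : v = w + m
    · subst h
      rw [if_pos (by ring), if_pos rfl, add_comm l m]
      congr 2
      push_cast
      ring
    · rw [if_neg h, if_neg, MulOpposite.op_zero]
      intro h'
      apply h
      linear_combination h'
  sum_path_zero := by
    rw [← MulOpposite.op_one, ← B.sum_path_zero, Finset.op_sum]
    simp only [Nat.cast_zero, sub_zero]
    exact Equiv.sum_comp (Equiv.neg (ZMod n)) fun v => MulOpposite.op (B.path v 0)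
  exists_path_eq_zero := by
    obtain ⟨N, hN⟩ := B.exists_path_eq_zero
    exact ⟨N, fun v l h => by rw [hN _ _ h, MulOpposite.op_zero]⟩
  path_one_ne_zero v h := B.path_one_ne_zero (-v - 1) (by simpa using h)
  coeff v l := B.coeff (-v - l) l ∘ₗ (MulOpposite.opLinearEquiv K).symm.toLinearMap
  coeff_path v l w m h := by
    have h' : B.path (-v - l) l ≠ 0 := fun h0 => h (by rw [h0, MulOpposite.op_zero])
    rw [LinearMap.comp_apply]
    refine (B.coeff_path _ _ (-w - m) m h').trans ?_
    congr 1
    rw [eq_iff_iff]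
    refine and_congr_left fun hm => ?_
    subst hm
    constructor
    · intro h; linear_combination -h
    · rintro rfl; rfl
  span_eq_top := by
    have h := congrArg (Submodule.map (MulOpposite.opLinearEquiv K : R ≃ₗ[K] Rᵐᵒᵖ).toLinearMap)
      B.span_eq_top
    rw [Submodule.map_span, Submodule.map_top, LinearEquiv.range, ← Set.range_comp] at h
    rw [← h]
    congr 1
    ext x
    constructor
    · rintro ⟨⟨v, l⟩, rfl⟩
      exact ⟨(-v - l, l), rfl⟩
    · rintro ⟨⟨v, l⟩, rfl⟩
      refine ⟨(-v - l, l), ?_⟩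
      change MulOpposite.op (B.path (-(-v - l) - l) l) = MulOpposite.op (B.path v l)
      congr 2
      ring

/-- The vertices `v` such that the arrow `v ⟶ v + 1` is the first arrow of a minimal zero path. -/
def firstArrows : Set (ZMod n) := {v | ∃ l, B.path (v + 1) l ≠ 0 ∧ B.path v (l + 1) = 0}

/-- The vertices `v` such that the arrow `v ⟶ v + 1` is the last arrow of a minimal zero path. -/
def lastArrows : Set (ZMod n) :=
  {v | ∃ w : ZMod n, ∃ l : ℕ, w + l = v ∧ B.path w l ≠ 0 ∧ B.path w (l + 1) = 0}

theorem mem_op_firstArrows (v : ZMod n) : v ∈ B.op.firstArrows ↔ -v - 1 ∈ B.lastArrows := by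
  have key (l : ℕ) : B.op.path (v + 1) l ≠ 0 ∧ B.op.path v (l + 1) = 0 ↔
      B.path (-v - 1 - l) l ≠ 0 ∧ B.path (-v - 1 - l) (l + 1) = 0 := by
    simp only [op, ne_eq, MulOpposite.op_eq_zero_iff]
    rw [show -(v + 1) - (l : ZMod n) = -v - 1 - l by ring,
      show -v - ((l + 1 : ℕ) : ZMod n) = -v - 1 - l by push_cast; ring]
  constructor
  · rintro ⟨l, h⟩
    exact ⟨-v - 1 - l, l, by ring, (key l).1 h⟩
  · rintro ⟨w, l, hw, h⟩
    obtain rfl : w = -v - 1 - l := by rw [← hw]; ring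
    exact ⟨l, (key l).2 h⟩

theorem mem_op_lastArrows (v : ZMod n) : v ∈ B.op.lastArrows ↔ -v - 1 ∈ B.firstArrows := by
  have key (w : ZMod n) (l : ℕ) (h : w + l = v) : B.op.path w l ≠ 0 ∧ B.op.path w (l + 1) = 0 ↔
      B.path (-v - 1 + 1) l ≠ 0 ∧ B.path (-v - 1) (l + 1) = 0 := by
    subst h
    simp only [op, ne_eq, MulOpposite.op_eq_zero_iff]
    rw [show -w - (l : ZMod n) = -(w + l) - 1 + 1 by ring,
      show -w - ((l + 1 : ℕ) : ZMod n) = -(w + l) - 1 by push_cast; ring]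
  constructor
  · rintro ⟨w, l, hw, h⟩
    exact ⟨l, (key w l hw).1 h⟩
  · rintro ⟨l, h⟩
    exact ⟨v - l, l, by ring, (key _ l (by ring)).2 h⟩

theorem linearMap_ext {M : Type*} [AddCommGroup M] [Module K M] {f g : R →ₗ[K] M}
    (h : ∀ v l, f (B.path v l) = g (B.path v l)) : f = g :=
  LinearMap.ext_on_range B.span_eq_top fun p => h p.1 p.2

theorem induction {P : R → Prop} (z : R) (hadd : ∀ x y, P x → P y → P (x + y))
    (hpath : ∀ (c : K) v l, P (c • B.path v l)) : P z := by
  have hz : z ∈ Submodule.span K (Set.range fun p : ZMod n × ℕ => B.path p.1 p.2) := by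
    rw [B.span_eq_top]; trivial
  induction hz using Submodule.closure_induction with
  | zero => simpa using hpath 0 0 0
  | add x y _ _ hx hy => exact hadd x y hx hy
  | smul_mem c x hx =>
    obtain ⟨p, rfl⟩ := hx
    exact hpath c p.1 p.2

theorem eq_zero_of_coeff_eq_zero {z : R} (h : ∀ v l, B.path v l ≠ 0 → B.coeff v l z = 0) :
    z = 0 := by
  have hz : z ∈ Submodule.span K (Set.range fun p : ZMod n × ℕ => B.path p.1 p.2) := by
    rw [B.span_eq_top]; trivial
  obtain ⟨c, rfl⟩ := (Finsupp.mem_span_range_iff_exists_finsupp).1 hz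
  refine Finset.sum_eq_zero fun p hp => ?_
  by_cases hp0 : B.path p.1 p.2 = 0
  · simp only [hp0, smul_zero]
  have hc := h p.1 p.2 hp0
  rw [Finsupp.sum, map_sum, Finset.sum_eq_single p] at hc
  · rw [map_smul, B.coeff_path _ _ _ _ hp0, if_pos ⟨rfl, rfl⟩, smul_eq_mul, mul_one] at hc
    simp only [hc, zero_smul]
  · intro q _ hq
    rw [map_smul, B.coeff_path _ _ _ _ hp0, if_neg, smul_zero]
    rintro ⟨h1, h2⟩
    exact hq (Prod.ext h1 h2)
  · intro h
    exact absurd hp h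

/-- The sum of all arrows. -/
def arrowSum : R := ∑ v, B.path v 1

theorem arrowSum_mul_path (v : ZMod n) (l : ℕ) : B.arrowSum * B.path v l = B.path v (l + 1) := by
  rw [arrowSum, Finset.sum_mul, Finset.sum_eq_single (v + l)]
  · rw [B.path_mul_path, if_pos rfl]
  · intro w _ hw
    rw [B.path_mul_path, if_neg hw]
  · intro h
    exact absurd (Finset.mem_univ _) h

theorem path_mul_arrowSum (v : ZMod n) (l : ℕ) :
    B.path v l * B.arrowSum = B.path (v - 1) (l + 1) := by
  rw [arrowSum, Finset.mul_sum, Finset.sum_eq_single (v - 1)]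
  · rw [B.path_mul_path, if_pos (by push_cast; ring), add_comm]
  · intro w _ hw
    rw [B.path_mul_path, if_neg]
    rintro rfl
    exact hw (by push_cast; ring)
  · intro h
    exact absurd (Finset.mem_univ _) h

theorem path_zero_mul_arrowSum (v : ZMod n) :
    B.path v 0 * B.arrowSum = B.arrowSum * B.path (v - 1) 0 := by
  rw [B.path_mul_arrowSum, B.arrowSum_mul_path]

theorem arrowSum_pow_mul_path (k : ℕ) (v : ZMod n) (l : ℕ) :
    B.arrowSum ^ k * B.path v l = B.path v (l + k) := by
  induction k with
  | zero => simp
  | succ k ih => rw [pow_succ', mul_assoc, ih, B.arrowSum_mul_path, add_assoc]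

theorem isNilpotent_arrowSum : IsNilpotent B.arrowSum := by
  obtain ⟨N, hN⟩ := B.exists_path_eq_zero
  refine ⟨N, ?_⟩
  rw [← mul_one (B.arrowSum ^ N), ← B.sum_path_zero, Finset.mul_sum]
  exact Finset.sum_eq_zero fun v _ => by rw [B.arrowSum_pow_mul_path, hN _ _ (by simp)]

/-- The sum α of the arrows can be moved to the left past any path at the cost of shifting its
source. Hence αR is a two-sided ideal, and it can play the role of the radical. -/
theorem exists_mul_arrowSum (z : R) : ∃ z', z * B.arrowSum = B.arrowSum * z' := by
  induction z using B.induction with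
  | hadd x y hx hy =>
    obtain ⟨x', hx⟩ := hx
    obtain ⟨y', hy⟩ := hy
    exact ⟨x' + y', by rw [add_mul, mul_add, hx, hy]⟩
  | hpath c v l =>
    exact ⟨c • B.path (v - 1) l, by
      rw [smul_mul_assoc, mul_smul_comm, B.path_mul_arrowSum, B.arrowSum_mul_path]⟩

theorem exists_mul_path_one (z : R) (v : ZMod n) : ∃ z', z * B.path v 1 = B.arrowSum * z' := by
  obtain ⟨z', h⟩ := B.exists_mul_arrowSum z
  refine ⟨z' * B.path v 0, ?_⟩
  rw [← mul_assoc, ← h, mul_assoc, B.arrowSum_mul_path]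

theorem isNilpotent_arrowSum_mul (z : R) : IsNilpotent (B.arrowSum * z) := by
  have key (k : ℕ) : ∃ z', (B.arrowSum * z) ^ k = B.arrowSum ^ k * z' := by
    induction k with
    | zero => exact ⟨1, by simp⟩
    | succ k ih =>
      obtain ⟨z', h⟩ := ih
      obtain ⟨z'', h'⟩ := B.exists_mul_arrowSum z'
      exact ⟨z'' * z, by rw [pow_succ, h, pow_succ, mul_assoc, ← mul_assoc z', h', mul_assoc,
        mul_assoc]⟩
  obtain ⟨N, hN⟩ := B.isNilpotent_arrowSum
  obtain ⟨z', h⟩ := key N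
  exact ⟨N, by rw [h, hN, zero_mul]⟩

theorem eq_zero_of_eq_mul_arrowSum_mul {p z : R} (h : p = p * (B.arrowSum * z)) : p = 0 := by
  have key (k : ℕ) : p = p * (B.arrowSum * z) ^ k := by
    induction k with
    | zero => simp
    | succ k ih => rw [pow_succ, ← mul_assoc, ← ih, ← h]
  obtain ⟨N, hN⟩ := B.isNilpotent_arrowSum_mul z
  rw [key N, hN, mul_zero]

theorem exists_eq_sum_add (z : R) :
    ∃ (a : ZMod n → K) (z' : R), z = ∑ v, a v • B.path v 0 + B.arrowSum * z' := by
  induction z using B.induction with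
  | hadd x y hx hy =>
    obtain ⟨a, x', hx⟩ := hx
    obtain ⟨b, y', hy⟩ := hy
    refine ⟨a + b, x' + y', ?_⟩
    rw [hx, hy, mul_add]
    simp only [Pi.add_apply, add_smul, Finset.sum_add_distrib]
    abel
  | hpath c v l =>
    cases l with
    | zero =>
      refine ⟨Pi.single v c, 0, ?_⟩
      rw [Finset.sum_eq_single v] <;> simp +contextual
    | succ l =>
      exact ⟨0, c • B.path v l, by simp [B.arrowSum_mul_path]⟩

theorem path_mul_sum (w : ZMod n) (l : ℕ) (a : ZMod n → K) :
    B.path w l * ∑ v, a v • B.path v 0 = a w • B.path w l := by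
  rw [Finset.mul_sum, Finset.sum_eq_single w]
  · rw [mul_smul_comm, B.path_mul_path, if_pos (by simp), zero_add]
  · intro v _ hv
    rw [mul_smul_comm, B.path_mul_path, if_neg (by simpa using hv.symm), smul_zero]
  · intro h
    exact absurd (Finset.mem_univ _) h

theorem path_zero_mul_path_zero (v : ZMod n) : B.path v 0 * B.path v 0 = B.path v 0 := by
  rw [B.path_mul_path, if_pos (by simp)]

/-- If `z` had a nonzero component at the trivial path of `w`, then `p z = 0` would express `p` as
`p` times an element of the nilpotent ideal αR, so `p` would vanish. -/
theorem exists_eq_arrowSum_mul {w : ZMod n} {l : ℕ} (hp : B.path w l ≠ 0) {z : R}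
    (hz : B.path w 0 * z = z) (h : B.path w l * z = 0) : ∃ z', z = B.arrowSum * z' := by
  obtain ⟨a, z₁, hz₁⟩ := B.exists_eq_sum_add z
  have ha : a w = 0 := by
    by_contra ha
    apply hp
    apply B.eq_zero_of_eq_mul_arrowSum_mul (z := -((a w)⁻¹ • z₁))
    rw [hz₁, mul_add, B.path_mul_sum] at h
    rw [mul_neg, mul_neg, mul_smul_comm, mul_smul_comm]
    rw [eq_neg_of_add_eq_zero_right h, smul_neg, neg_neg, smul_smul, inv_mul_cancel₀ ha, one_smul]
  rw [hz₁, mul_add, B.path_mul_sum, ha, zero_smul, zero_add, ← mul_assoc,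
    B.path_zero_mul_arrowSum, mul_assoc] at hz
  exact ⟨_, hz₁.trans hz.symm⟩

/-- Every nonzero path ending at such a `v` can be prolonged to a nonzero path, so the coefficients
of `z` reappear in αz. In other words, S_v does not occur in the socle of the regular module. -/
theorem eq_zero_of_arrowSum_mul_eq_zero {v : ZMod n} (hv : v ∉ B.lastArrows) {z : R}
    (hz : B.path v 0 * z = z) (h : B.arrowSum * z = 0) : z = 0 := by
  refine B.eq_zero_of_coeff_eq_zero fun w l hp => ?_
  by_cases hw : w + l = v
  · have hp' : B.path w (l + 1) ≠ 0 := fun h0 => hv ⟨w, l, hw, hp, h0⟩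
    have : B.coeff w l = B.coeff w (l + 1) ∘ₗ LinearMap.mulLeft K B.arrowSum := by
      refine B.linearMap_ext fun u m => ?_
      rw [LinearMap.comp_apply, LinearMap.mulLeft_apply, B.arrowSum_mul_path,
        B.coeff_path _ _ _ _ hp, B.coeff_path _ _ _ _ hp']
      simp
    rw [this, LinearMap.comp_apply, LinearMap.mulLeft_apply, h, map_zero]
  · have : B.coeff w l ∘ₗ LinearMap.mulLeft K (B.path v 0) = 0 := by
      refine B.linearMap_ext fun u m => ?_
      rw [LinearMap.comp_apply, LinearMap.mulLeft_apply, B.path_mul_path, LinearMap.zero_apply]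
      split_ifs with hu
      · rw [add_zero, B.coeff_path _ _ _ _ hp, if_neg]
        rintro ⟨rfl, rfl⟩
        exact hw hu.symm
      · exact map_zero _
    rw [← hz]
    exact LinearMap.congr_fun this z

theorem eq_zero_of_mul_arrowSum_eq_zero {v : ZMod n} (hv : v ∉ B.firstArrows) {z : R}
    (hz : z * B.path (v + 1) 0 = z) (h : z * B.path v 1 = 0) : z = 0 := by
  have hv' : -v - 1 ∉ B.op.lastArrows := by
    rw [mem_op_lastArrows]
    convert hv using 2
    ring
  have h0 : B.op.path (-v - 1) 0 = MulOpposite.op (B.path (v + 1) 0) := by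
    change MulOpposite.op (B.path (-(-v - 1) - ((0 : ℕ) : ZMod n)) 0) = _
    congr 2
    push_cast; ring
  have h1 : B.op.arrowSum * B.op.path (-v - 1) 0 = MulOpposite.op (B.path v 1) := by
    rw [arrowSum_mul_path]
    change MulOpposite.op (B.path (-(-v - 1) - ((1 : ℕ) : ZMod n)) 1) = _
    congr 2
    push_cast; ring
  have hz' : B.op.path (-v - 1) 0 * MulOpposite.op z = MulOpposite.op z := by
    rw [h0, ← MulOpposite.op_mul, hz]
  have := B.op.eq_zero_of_arrowSum_mul_eq_zero hv' (z := MulOpposite.op z) hz'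
    (by rw [← hz', ← mul_assoc, h1, ← MulOpposite.op_mul, h, MulOpposite.op_zero])
  simpa using this

end PathBasis

/-! ### Radicals and splitting of maps between projective modules -/

namespace PathBasis

section

variable {K R : Type*} [Field K] [Ring R] [Algebra K R] {n : ℕ} [NeZero n] (B : PathBasis K R n)
  {M N P Q : Type*} [AddCommGroup M] [Module R M] [AddCommGroup N] [Module R N]
  [AddCommGroup P] [Module R P] [AddCommGroup Q] [Module R Q]

theorem sum_path_zero_smul (x : M) : ∑ v, B.path v 0 • x = x := by
  rw [← Finset.sum_smul, B.sum_path_zero, one_smul]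

variable (M) in
/-- The multiples `α x` of the sum `α` of all arrows form a submodule, the radical of `M`. -/
def radical : Submodule R M where
  carrier := {x | ∃ y, x = B.arrowSum • y}
  zero_mem' := ⟨0, by simp⟩
  add_mem' := by
    rintro _ _ ⟨x, rfl⟩ ⟨y, rfl⟩
    exact ⟨x + y, by rw [smul_add]⟩
  smul_mem' := by
    rintro r _ ⟨x, rfl⟩
    obtain ⟨r', h⟩ := B.exists_mul_arrowSum r
    exact ⟨r' • x, by rw [← mul_smul, h, mul_smul]⟩

theorem arrowSum_smul_mem (x : M) : B.arrowSum • x ∈ B.radical M := ⟨x, rfl⟩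

/-- A section of the canonical map from a free module onto P reduces the claim to coordinates in R,
where `exists_eq_arrowSum_mul` applies. -/
theorem mem_radical_of_smul_eq_zero [Module.Projective R P] {w : ZMod n} {l : ℕ}
    (hp : B.path w l ≠ 0) {x : P} (hx : B.path w 0 • x = x) (h : B.path w l • x = 0) :
    x ∈ B.radical P := by
  obtain ⟨s, hs⟩ := Module.projective_def'.1 (inferInstance : Module.Projective R P)
  have hx' : x = Finsupp.linearCombination R id (s x) := (LinearMap.congr_fun hs x).symm
  rw [hx']
  refine Submodule.sum_mem _ fun i _ => ?_
  have h1 : B.path w 0 * s x i = s x i := by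
    have := congrArg (fun f => f i) (congrArg s hx)
    simpa using this
  have h2 : B.path w l * s x i = 0 := by
    have := congrArg (fun f => f i) (congrArg s h)
    simpa using this
  obtain ⟨z, hz⟩ := B.exists_eq_arrowSum_mul hp h1 h2
  refine ⟨z • i, ?_⟩
  simp only [LinearMap.smulRight_apply, LinearMap.id_apply, id, hz, mul_smul]

/-- If `P` is projective and the cokernel of `P → Q` has no relevant torsion, then the intersection
of `P` with the radical of `Q` is the radical of `P`. -/
theorem mem_radical_of_map_mem_radical [Module.Projective R P] (f : P →ₗ[R] Q) (g : Q →ₗ[R] M)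
    (hf : Function.Injective f) (hfg : Function.Exact f g)
    (hM : ∀ v ∉ B.firstArrows, ∀ m : M, B.path v 0 • m = m → B.arrowSum • m = 0 → m = 0)
    {x : P} (hx : f x ∈ B.radical Q) : x ∈ B.radical P := by
  obtain ⟨y, hy⟩ := hx
  rw [← B.sum_path_zero_smul x]
  refine Submodule.sum_mem _ fun w _ => ?_
  obtain ⟨v, rfl⟩ : ∃ v, w = v + 1 := ⟨w - 1, by ring⟩
  have hxy : f (B.path (v + 1) 0 • x) = B.arrowSum • B.path v 0 • y := by
    rw [map_smul, hy, ← mul_smul, B.path_zero_mul_arrowSum, mul_smul, add_sub_cancel_right]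
  have hx0 : B.path (v + 1) 0 • B.path (v + 1) 0 • x = B.path (v + 1) 0 • x := by
    rw [← mul_smul, B.path_zero_mul_path_zero]
  -- For a first arrow, the rest of its minimal zero path kills the component of `x` at `v + 1`
  -- without being zero itself. Otherwise the component of `y` at `v` maps to an element of M killed
  -- by α, hence to 0, and so it comes from P.
  by_cases hv : v ∈ B.firstArrows
  · obtain ⟨l, hl, hl'⟩ := hv
    refine B.mem_radical_of_smul_eq_zero hl hx0 (hf ?_)
    rw [map_zero, map_smul, hxy, ← mul_smul, ← mul_smul, B.path_mul_arrowSum, add_sub_cancel_right,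
      hl', zero_mul, zero_smul]
  · have h0 : g (B.path v 0 • y) = 0 := by
      refine hM v hv _ ?_ ?_
      · rw [← map_smul, ← mul_smul, B.path_zero_mul_path_zero]
      · rw [← map_smul, ← hxy]
        exact hfg.apply_apply_eq_zero _
    obtain ⟨z, hz⟩ := (hfg _).1 h0
    exact ⟨z, hf (by rw [hxy, ← hz, map_smul])⟩

theorem path_succ_smul_eq_zero (hM : ∀ m : M, B.arrowSum • m = 0) (v : ZMod n) (l : ℕ) (m : M) :
    B.path v (l + 1) • m = 0 := by
  rw [← B.arrowSum_mul_path, mul_smul, hM]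

theorem path_zero_smul_path_zero_smul (w v : ZMod n) (x : M) :
    B.path w 0 • B.path v 0 • x = if w = v then B.path v 0 • x else 0 := by
  rw [← mul_smul, B.path_mul_path]
  simp only [Nat.cast_zero, add_zero, ite_smul, zero_smul]

theorem arrowSum_smul_quotient (m : M ⧸ B.radical M) : B.arrowSum • m = 0 := by
  obtain ⟨m, rfl⟩ := Submodule.Quotient.mk_surjective _ m
  rw [← Submodule.Quotient.mk_smul, Submodule.Quotient.mk_eq_zero]
  exact B.arrowSum_smul_mem m

/-- Over a path basis, injections between modules killed by the arrows split. -/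
theorem exists_leftInverse_of_arrowSum_smul_eq_zero [Module K M] [IsScalarTower K R M]
    [Module K N] [IsScalarTower K R N] (f : M →ₗ[R] N) (hf : Function.Injective f)
    (hM : ∀ m : M, B.arrowSum • m = 0) (hN : ∀ m : N, B.arrowSum • m = 0) :
    ∃ g : N →ₗ[R] M, g ∘ₗ f = LinearMap.id := by
  obtain ⟨ρ, hρ⟩ := (f.restrictScalars K).exists_leftInverse_of_injective
    (LinearMap.ker_eq_bot.2 hf)
  have hρ' (x : M) : ρ (f x) = x := LinearMap.congr_fun hρ x
  -- A K-linear retraction made compatible with the vertex idempotents; longer paths act as zero on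
  -- both sides, so nothing more is needed for linearity over R.
  let τ : N → M := fun x => ∑ v, B.path v 0 • ρ (B.path v 0 • x)
  have hadd (x y : N) : τ (x + y) = τ x + τ y := by
    simp only [τ, smul_add, map_add, Finset.sum_add_distrib]
  refine ⟨{ toFun := τ, map_add' := hadd, map_smul' := fun r x => ?_ }, ?_⟩
  · induction r using B.induction with
    | hadd a b ha hb => rw [add_smul, hadd, ha, hb, RingHom.id_apply, RingHom.id_apply,
        RingHom.id_apply, add_smul]
    | hpath c v l =>
      rw [RingHom.id_apply]
      cases l with
      | succ l =>
        rw [smul_assoc, smul_assoc, B.path_succ_smul_eq_zero hM, B.path_succ_smul_eq_zero hN]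
        simp [τ]
      | zero =>
        simp only [τ]
        rw [Finset.smul_sum]
        refine Finset.sum_congr rfl fun w _ => ?_
        have h1 : B.path w 0 • (c • B.path v 0) • x = c • B.path w 0 • B.path v 0 • x := by
          rw [← mul_smul, mul_smul_comm, smul_assoc, mul_smul]
        rw [h1, B.path_zero_smul_path_zero_smul, smul_assoc,
          B.path_zero_smul_path_zero_smul, map_smul, ← algebraMap_smul R c, ← mul_smul,
          ← Algebra.commutes, mul_smul, algebraMap_smul]
        by_cases h : v = w
        · subst h; simp
        · rw [if_neg h, if_neg (Ne.symm h), map_zero, smul_zero, smul_zero]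
  · ext x
    change τ (f x) = x
    simp only [τ, ← map_smul, hρ', ← mul_smul, B.path_zero_mul_path_zero]
    exact B.sum_path_zero_smul x

/-- A map between projective modules that is injective modulo radicals splits. -/
theorem exists_leftInverse_of_injective_mod_radical [Module K P] [IsScalarTower K R P]
    [Module K Q] [IsScalarTower K R Q] [Module.Projective R Q] (f : P →ₗ[R] Q)
    (h : ∀ x, f x ∈ B.radical Q → x ∈ B.radical P) : ∃ g : Q →ₗ[R] P, g ∘ₗ f = LinearMap.id := by
  have hle : B.radical P ≤ (B.radical Q).comap f := by
    rintro _ ⟨x, rfl⟩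
    exact ⟨f x, by rw [map_smul]⟩
  have hinj : Function.Injective ((B.radical P).mapQ (B.radical Q) f hle) := by
    rw [← LinearMap.ker_eq_bot, Submodule.ker_mapQ, eq_bot_iff, Submodule.map_le_iff_le_comap]
    intro x hx
    exact (Submodule.Quotient.mk_eq_zero _).2 (h x hx)
  obtain ⟨ρ, hρ⟩ := B.exists_leftInverse_of_arrowSum_smul_eq_zero _ hinj
    B.arrowSum_smul_quotient B.arrowSum_smul_quotient
  obtain ⟨σ, hσ⟩ := Module.projective_lifting_property (B.radical P).mkQ (ρ ∘ₗ (B.radical Q).mkQ)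
    (Submodule.mkQ_surjective _)
  -- The lift σ is a retraction only modulo the radical. The error `1 - σ ∘ f` is therefore
  -- nilpotent, and `σ ∘ f` is invertible.
  have hν (x : P) : ((1 : Module.End R P) - σ ∘ₗ f) x ∈ B.radical P := by
    rw [← Submodule.Quotient.mk_eq_zero]
    have h1 : (B.radical P).mkQ (σ (f x)) = ρ ((B.radical Q).mkQ (f x)) :=
      LinearMap.congr_fun hσ (f x)
    have h2 : ρ ((B.radical Q).mkQ (f x)) = (B.radical P).mkQ x :=
      LinearMap.congr_fun hρ ((B.radical P).mkQ x)
    change (B.radical P).mkQ (x - σ (f x)) = 0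
    rw [map_sub, h1, h2, sub_self]
  have hpow (k : ℕ) (x : P) : ∃ y, (((1 : Module.End R P) - σ ∘ₗ f) ^ k) x = B.arrowSum ^ k • y := by
    induction k generalizing x with
    | zero => exact ⟨x, by simp⟩
    | succ k ih =>
      obtain ⟨z, hz⟩ := hν x
      obtain ⟨y, hy⟩ := ih z
      refine ⟨y, ?_⟩
      rw [pow_succ, Module.End.mul_apply, hz, map_smul, hy, ← mul_smul, ← pow_succ']
  obtain ⟨N, hN⟩ := B.isNilpotent_arrowSum
  have hnil : IsNilpotent ((1 : Module.End R P) - σ ∘ₗ f) := by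
    refine ⟨N, LinearMap.ext fun x => ?_⟩
    obtain ⟨y, hy⟩ := hpow N x
    rw [hy, hN, zero_smul, LinearMap.zero_apply]
  obtain ⟨u, hu⟩ := hnil.isUnit_one_sub
  rw [sub_sub_cancel] at hu
  refine ⟨(↑u⁻¹ : Module.End R P) ∘ₗ σ, ?_⟩
  rw [LinearMap.comp_assoc, ← hu]
  exact u.inv_mul

theorem projective_of_exact [Module.Projective R P] [Module.Projective R Q]
    (f : P →ₗ[R] Q) (g : Q →ₗ[R] M) (hf : Function.Injective f) (hfg : Function.Exact f g)
    (hg : Function.Surjective g)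
    (hM : ∀ v ∉ B.firstArrows, ∀ m : M, B.path v 0 • m = m → B.arrowSum • m = 0 → m = 0) :
    Module.Projective R M := by
  let _ : Module K P := Module.compHom P (algebraMap K R)
  let _ : Module K Q := Module.compHom Q (algebraMap K R)
  have : IsScalarTower K R P := ⟨fun c r x => by rw [Algebra.smul_def, mul_smul]; rfl⟩
  have : IsScalarTower K R Q := ⟨fun c r x => by rw [Algebra.smul_def, mul_smul]; rfl⟩
  have hsplit := B.exists_leftInverse_of_injective_mod_radical f fun x hx =>
    B.mem_radical_of_map_mem_radical f g hf hfg hM hx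
  obtain ⟨s, hs⟩ := ((hfg.split_tfae hf hg).out 1 0).1 hsplit
  exact Module.Projective.of_split s g hs

end

/-! ### Upper bounds for finite projective dimensions -/

section

variable {R : Type u} [Ring R]

theorem hasProjectiveDimensionLT_ker_iff {P M : Type u} [AddCommGroup P] [Module R P]
    [AddCommGroup M] [Module R M] [Module.Projective R P] (g : P →ₗ[R] M)
    (hg : Function.Surjective g) (d : ℕ) :
    HasProjectiveDimensionLT (ModuleCat.of R M) (d + 2) ↔
      HasProjectiveDimensionLT (ModuleCat.of R (LinearMap.ker g)) (d + 1) :=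
  (LinearMap.shortExact_shortComplexKer hg).hasProjectiveDimensionLT_X₃_iff d
    (ModuleCat.projective_of_categoryTheory_projective _)

theorem hasProjectiveDimensionLT_one_iff (M : Type u) [AddCommGroup M] [Module R M] :
    HasProjectiveDimensionLT (ModuleCat.of R M) 1 ↔ Module.Projective R M := by
  rw [IsProjective.iff_projective, projective_iff_hasProjectiveDimensionLT_one]

variable {K : Type*} [Field K] [Algebra K R] {n : ℕ} [NeZero n] (B : PathBasis K R n)

theorem projective_of_hasProjectiveDimensionLT_two (M : Type u) [AddCommGroup M] [Module R M]
    (h : HasProjectiveDimensionLT (ModuleCat.of R M) 2)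
    (hM : ∀ v ∉ B.firstArrows, ∀ m : M, B.path v 0 • m = m → B.arrowSum • m = 0 → m = 0) :
    Module.Projective R M := by
  have hg := Finsupp.linearCombination_id_surjective R M
  rw [hasProjectiveDimensionLT_ker_iff _ hg, hasProjectiveDimensionLT_one_iff] at h
  have hex := LinearMap.exact_subtype_ker_map (Finsupp.linearCombination R (id : M → M))
  exact B.projective_of_exact _ _ (Submodule.injective_subtype _) hex hg hM

/-- The syzygy lies in a free module, whose socle involves only last arrows. These are first arrows
here, so the syzygy meets the torsion condition and becomes projective as soon as induction bounds
its projective dimension by 1. -/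
theorem hasProjectiveDimensionLT_two_of_subset (hsub : B.lastArrows ⊆ B.firstArrows) (d : ℕ)
    (M : Type u) [AddCommGroup M] [Module R M]
    (h : HasProjectiveDimensionLT (ModuleCat.of R M) (d + 1)) :
    HasProjectiveDimensionLT (ModuleCat.of R M) 2 := by
  induction d generalizing M with
  | zero => exact hasProjectiveDimensionLT_of_ge _ 1 2 (by norm_num)
  | succ d ih =>
    have hg := Finsupp.linearCombination_id_surjective R M
    rw [hasProjectiveDimensionLT_ker_iff _ hg] at h
    rw [hasProjectiveDimensionLT_ker_iff _ hg 0, hasProjectiveDimensionLT_one_iff]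
    refine B.projective_of_hasProjectiveDimensionLT_two _ (ih _ h) fun v hv m h1 h2 => ?_
    ext i
    refine B.eq_zero_of_arrowSum_mul_eq_zero (fun h => hv (hsub h)) ?_ ?_
    · exact congrArg (fun x : LinearMap.ker _ => (x : M →₀ R) i) h1
    · exact congrArg (fun x : LinearMap.ker _ => (x : M →₀ R) i) h2

theorem projective_of_firstArrows_eq_univ (hF : B.firstArrows = Set.univ) (d : ℕ)
    (M : Type u) [AddCommGroup M] [Module R M]
    (h : HasProjectiveDimensionLT (ModuleCat.of R M) (d + 1)) : Module.Projective R M :=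
  B.projective_of_hasProjectiveDimensionLT_two M
    (B.hasProjectiveDimensionLT_two_of_subset (hF ▸ Set.subset_univ _) d M h)
    fun v hv => absurd (hF ▸ Set.mem_univ v) hv

end

end PathBasis

/-! ### Cyclic modules of projective dimension 1 and 2, and the criterion for the finitistic
dimension -/

namespace PathBasis

section

variable {K R : Type*} [Field K] [Ring R] [Algebra K R] {n : ℕ} [NeZero n] (B : PathBasis K R n)

/-- Mirror image of `exists_eq_arrowSum_mul` in the opposite algebra. It computes the kernel of the
projective cover of the left ideal generated by a longest nonzero path. -/
theorem exists_eq_mul_path_one {w v : ZMod n} {l : ℕ} (hv : w + l = v) (hp : B.path w l ≠ 0) {z : R}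
    (hz : z * B.path v 0 = z) (h : z * B.path w l = 0) : ∃ z', z = z' * B.path v 1 := by
  subst hv
  have hpath (l : ℕ) : B.op.path (-(w + l)) l = MulOpposite.op (B.path w l) := by
    change MulOpposite.op (B.path (-(-(w + l)) - l) l) = _
    congr 2
    ring
  have h0 : B.op.path (-(w + l)) 0 = MulOpposite.op (B.path (w + l) 0) := by
    change MulOpposite.op (B.path (-(-(w + l)) - ((0 : ℕ) : ZMod n)) 0) = _
    congr 2
    push_cast; ring
  have hz' : B.op.path (-(w + l)) 0 * MulOpposite.op z = MulOpposite.op z := by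
    rw [h0, ← MulOpposite.op_mul, hz]
  obtain ⟨y, hy⟩ := B.op.exists_eq_arrowSum_mul (w := -(w + l)) (l := l)
    (by rw [hpath]; simpa using hp) hz' (by rw [hpath, ← MulOpposite.op_mul, h, MulOpposite.op_zero])
  have ha : B.op.arrowSum = MulOpposite.op B.arrowSum := by
    rw [arrowSum, arrowSum, Finset.op_sum]
    refine Fintype.sum_equiv (Equiv.subLeft (-1)) _ _ fun v => ?_
    change MulOpposite.op (B.path (-v - ((1 : ℕ) : ZMod n)) 1) = MulOpposite.op (B.path (-1 - v) 1)
    congr 2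
    push_cast; ring
  have hy' : z = y.unop * B.arrowSum := by
    have := congrArg MulOpposite.unop hy
    rwa [ha] at this
  exact ⟨y.unop, by rw [← zero_add 1, ← B.arrowSum_mul_path, ← mul_assoc, ← hy', hz]⟩

theorem eq_zero_of_eq_arrowSum_mul_mul {p z : R} (h : p = B.arrowSum * z * p) : p = 0 := by
  have key (k : ℕ) : p = (B.arrowSum * z) ^ k * p := by
    induction k with
    | zero => simp
    | succ k ih => rw [pow_succ, mul_assoc, ← h, ← ih]
  obtain ⟨N, hN⟩ := B.isNilpotent_arrowSum_mul z
  rw [key N, hN, zero_mul]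

theorem projective_span_idempotent {e : R} (he : e * e = e) :
    Module.Projective R (Ideal.span {e} : Ideal R) := by
  let s : R →ₗ[R] (Ideal.span {e} : Ideal R) := (LinearMap.toSpanSingleton R R e).codRestrict _
    fun z => Ideal.mul_mem_left _ _ (Ideal.mem_span_singleton_self e)
  refine Module.Projective.of_split (Ideal.span {e} : Ideal R).subtype s (LinearMap.ext fun x => ?_)
  obtain ⟨x, hx⟩ := x
  obtain ⟨z, rfl⟩ := Ideal.mem_span_singleton'.1 hx
  refine Subtype.ext ?_
  change z * e * e = z * e
  rw [mul_assoc, he]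

/-- Right multiplication by `q`, from the left ideal generated by `e` to the one generated
by `q`. -/
def mulRightSpan (e q : R) : (Ideal.span {e} : Ideal R) →ₗ[R] (Ideal.span {q} : Ideal R) :=
  ((LinearMap.toSpanSingleton R R q).codRestrict (Ideal.span {q} : Ideal R)
    fun _ => Ideal.mul_mem_left _ _ (Ideal.mem_span_singleton_self q)) ∘ₗ Submodule.subtype _

theorem mulRightSpan_apply (e q : R) (x : (Ideal.span {e} : Ideal R)) :
    (mulRightSpan e q x : R) = x * q := rfl

theorem mulRightSpan_surjective {e q : R} (h : e * q = q) :
    Function.Surjective (mulRightSpan e q) := by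
  rintro ⟨x, hx⟩
  obtain ⟨z, rfl⟩ := Ideal.mem_span_singleton'.1 hx
  refine ⟨⟨z * e, Ideal.mul_mem_left _ _ (Ideal.mem_span_singleton_self e)⟩, Subtype.ext ?_⟩
  rw [mulRightSpan_apply, mul_assoc, h]

theorem mul_path_zero_of_mem_span {v : ZMod n} {z : R}
    (hz : z ∈ (Ideal.span {B.path v 0} : Ideal R)) : z * B.path v 0 = z := by
  obtain ⟨y, rfl⟩ := Ideal.mem_span_singleton'.1 hz
  rw [mul_assoc, B.path_zero_mul_path_zero]

theorem projective_span_path_one {v : ZMod n} (hv : v ∉ B.firstArrows) :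
    Module.Projective R (Ideal.span {B.path v 1} : Ideal R) := by
  have := projective_span_idempotent (B.path_zero_mul_path_zero (v + 1))
  refine Module.Projective.of_equiv (LinearEquiv.ofBijective
    (mulRightSpan (B.path (v + 1) 0) (B.path v 1)) ⟨?_, mulRightSpan_surjective ?_⟩)
  · rw [← LinearMap.ker_eq_bot, LinearMap.ker_eq_bot']
    rintro ⟨z, hz⟩ h
    exact Subtype.ext (B.eq_zero_of_mul_arrowSum_eq_zero hv (B.mul_path_zero_of_mem_span hz)
      (congrArg Subtype.val h))
  · rw [B.path_mul_path, if_pos (by push_cast; ring)]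

/-- In a projective module the class of the idempotent at `v`, being killed by the nonzero arrow
α_v, would lie in the radical. The idempotent would then lie in the nilpotent ideal αR. -/
theorem not_projective_quotient_span_path_one (v : ZMod n) :
    ¬ Module.Projective R (R ⧸ (Ideal.span {B.path v 1} : Ideal R)) := by
  intro h
  have hmem := B.mem_radical_of_smul_eq_zero (B.path_one_ne_zero v)
    (x := (Ideal.span {B.path v 1} : Ideal R).mkQ (B.path v 0))
    (by rw [← map_smul, smul_eq_mul, B.path_zero_mul_path_zero])
    (by
      rw [← map_smul, smul_eq_mul, B.path_mul_path, if_pos (by simp), zero_add]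
      exact (Submodule.Quotient.mk_eq_zero _).2 (Ideal.mem_span_singleton_self _))
  obtain ⟨y, hy⟩ := hmem
  obtain ⟨y, rfl⟩ := Submodule.mkQ_surjective _ y
  rw [← map_smul, ← sub_eq_zero, ← map_sub] at hy
  obtain ⟨z, hz⟩ := Ideal.mem_span_singleton'.1 ((Submodule.Quotient.mk_eq_zero _).1 hy)
  obtain ⟨z', hz'⟩ := B.exists_mul_path_one z v
  have h0 : B.path v 0 = 0 := by
    apply B.eq_zero_of_eq_mul_arrowSum_mul (z := z' + y)
    have h1 : B.path v 0 = B.arrowSum * (z' + y) := by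
      rw [mul_add, ← hz', hz, smul_eq_mul, sub_add_cancel]
    rw [← h1, B.path_zero_mul_path_zero]
  exact B.path_one_ne_zero v (by rw [← zero_add 1, ← B.arrowSum_mul_path, h0, mul_zero])

theorem not_projective_span_path {w : ZMod n} {l : ℕ} (hp : B.path w l ≠ 0)
    (hp' : B.path w (l + 1) = 0) : ¬ Module.Projective R (Ideal.span {B.path w l} : Ideal R) := by
  intro h
  obtain ⟨⟨y, hy⟩, hxy⟩ := B.mem_radical_of_smul_eq_zero (B.path_one_ne_zero (w + l))
    (x := (⟨B.path w l, Ideal.mem_span_singleton_self _⟩ : (Ideal.span {B.path w l} : Ideal R)))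
    (Subtype.ext (by
      change B.path (w + l) 0 * B.path w l = B.path w l
      rw [B.path_mul_path, if_pos rfl, add_zero]))
    (Subtype.ext (by
      change B.path (w + l) 1 * B.path w l = 0
      rw [B.path_mul_path, if_pos rfl, hp']))
  obtain ⟨z, rfl⟩ := Ideal.mem_span_singleton'.1 hy
  refine hp (B.eq_zero_of_eq_arrowSum_mul_mul (z := z) ?_)
  rw [mul_assoc]
  exact congrArg Subtype.val hxy

end

section

variable {K : Type*} {R : Type u} [Field K] [Ring R] [Algebra K R] {n : ℕ} [NeZero n]
  (B : PathBasis K R n)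

theorem hasProjectiveDimensionLT_quotient_iff (I : Ideal R) (d : ℕ) :
    HasProjectiveDimensionLT (ModuleCat.of R (R ⧸ I)) (d + 2) ↔
      HasProjectiveDimensionLT (ModuleCat.of R I) (d + 1) := by
  rw [hasProjectiveDimensionLT_ker_iff I.mkQ I.mkQ_surjective, Submodule.ker_mkQ]

theorem projectiveDimension_eq_of_hasProjectiveDimensionLT {M : ModuleCat.{u} R} {d : ℕ}
    (h : HasProjectiveDimensionLT M (d + 1)) (h' : ¬ HasProjectiveDimensionLT M d) :
    projectiveDimension M = d :=
  le_antisymm ((projectiveDimension_le_iff M d).2 h) ((projectiveDimension_ge_iff M d).2 h')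

theorem projectiveDimension_quotient_span_path_one {v : ZMod n} (hv : v ∉ B.firstArrows) :
    projectiveDimension (ModuleCat.of R (R ⧸ (Ideal.span {B.path v 1} : Ideal R))) =
      (1 : ℕ) := by
  refine projectiveDimension_eq_of_hasProjectiveDimensionLT ?_ ?_
  · rw [hasProjectiveDimensionLT_quotient_iff _ 0, hasProjectiveDimensionLT_one_iff]
    exact B.projective_span_path_one hv
  · rw [hasProjectiveDimensionLT_one_iff]
    exact B.not_projective_quotient_span_path_one v

theorem projectiveDimension_quotient_span_path {w : ZMod n} {l : ℕ}
    (hv : w + l ∉ B.firstArrows) (hp : B.path w l ≠ 0) (hp' : B.path w (l + 1) = 0) :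
    projectiveDimension (ModuleCat.of R (R ⧸ (Ideal.span {B.path w l} : Ideal R))) =
      (2 : ℕ) := by
  refine projectiveDimension_eq_of_hasProjectiveDimensionLT ?_ ?_
  · have := projective_span_idempotent (B.path_zero_mul_path_zero (w + l))
    have := B.projective_span_path_one hv
    have hsurj : Function.Surjective (mulRightSpan (B.path (w + l) 0) (B.path w l)) :=
      mulRightSpan_surjective (by rw [B.path_mul_path, if_pos rfl, add_zero])
    rw [hasProjectiveDimensionLT_quotient_iff _ 1, hasProjectiveDimensionLT_ker_iff _ hsurj 0,
      hasProjectiveDimensionLT_one_iff]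
    -- The second syzygy is the left ideal generated by the arrow at `w + l`, projective because
    -- this arrow is not a first arrow.
    have hle : (Ideal.span {B.path (w + l) 1} : Ideal R) ≤ Ideal.span {B.path (w + l) 0} := by
      rw [Ideal.span_le, Set.singleton_subset_iff, SetLike.mem_coe, ← zero_add 1,
        ← B.arrowSum_mul_path]
      exact Ideal.mul_mem_left _ _ (Ideal.mem_span_singleton_self _)
    refine Module.Projective.of_equiv (LinearEquiv.ofBijective
      ((Submodule.inclusion hle).codRestrict (LinearMap.ker _) ?_) ⟨?_, ?_⟩)
    · rintro ⟨x, hx⟩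
      obtain ⟨z, rfl⟩ := Ideal.mem_span_singleton'.1 hx
      refine Subtype.ext ?_
      change z * B.path (w + l) 1 * B.path w l = 0
      rw [mul_assoc, B.path_mul_path, if_pos rfl, hp', mul_zero]
    · intro x y h
      exact Submodule.inclusion_injective hle (congrArg Subtype.val h)
    · rintro ⟨⟨z, hz⟩, hzq⟩
      obtain ⟨z', rfl⟩ := B.exists_eq_mul_path_one rfl hp (B.mul_path_zero_of_mem_span hz)
        (congrArg Subtype.val hzq)
      exact ⟨⟨_, Ideal.mul_mem_left _ _ (Ideal.mem_span_singleton_self _)⟩, rfl⟩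
  · rw [hasProjectiveDimensionLT_quotient_iff _ 0, hasProjectiveDimensionLT_one_iff]
    exact B.not_projective_span_path hp hp'

theorem le_findim {M : ModuleCat.{u} R} [Module.Finite R M] {d : ℕ}
    (h : projectiveDimension M = d) : (d : WithBot ℕ∞) ≤ findim R :=
  le_sSup ⟨M, inferInstance, by rw [h]; exact WithBot.coe_injective.ne (ENat.natCast_ne_top d), h.symm⟩

theorem findim_le {d : ℕ}
    (h : ∀ (e : ℕ) (M : Type u) [AddCommGroup M] [Module R M],
      HasProjectiveDimensionLT (ModuleCat.of R M) (e + 1) →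
        HasProjectiveDimensionLT (ModuleCat.of R M) (d + 1)) : findim R ≤ d := by
  refine sSup_le ?_
  rintro _ ⟨M, -, hM, rfl⟩
  obtain ⟨e, he⟩ := (projectiveDimension_ne_top_iff M).1 hM
  exact (projectiveDimension_le_iff M d).2 (h e M he)

theorem findim_eq_one_iff :
    findim R = 1 ↔ B.lastArrows ⊆ B.firstArrows ∧ B.firstArrows ≠ Set.univ := by
  constructor
  · refine fun h => ⟨fun v hv => ?_, fun hF => ?_⟩
    · by_contra hv'
      obtain ⟨w, l, rfl, hp, hp'⟩ := hv
      have := le_findim (B.projectiveDimension_quotient_span_path hv' hp hp')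
      rw [h] at this
      exact absurd this (by norm_num)
    · have := findim_le (R := R) (d := 0) fun e M _ _ hM =>
        (hasProjectiveDimensionLT_one_iff M).2 (B.projective_of_firstArrows_eq_univ hF e M hM)
      rw [h] at this
      exact absurd this (by norm_num)
  · rintro ⟨hsub, hF⟩
    refine le_antisymm ?_ ?_
    · exact_mod_cast findim_le (R := R) (d := 1) fun e M _ _ hM =>
        B.hasProjectiveDimensionLT_two_of_subset hsub e M hM
    · obtain ⟨v, hv⟩ := (Set.ne_univ_iff_exists_notMem _).1 hF
      exact_mod_cast le_findim (B.projectiveDimension_quotient_span_path_one hv)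

/-- Equal cardinalities turn the one-sided inclusion into an equality, which is what makes the
criterion left-right symmetric. -/
theorem findim_eq_one_iff_of_ncard_eq (h : B.lastArrows.ncard = B.firstArrows.ncard) :
    findim R = 1 ↔ B.lastArrows = B.firstArrows ∧ B.firstArrows ≠ Set.univ := by
  rw [B.findim_eq_one_iff]
  refine and_congr_left fun _ => ⟨fun hsub => ?_, fun h => h.subset⟩
  exact Set.eq_of_subset_of_ncard_le hsub h.ge (Set.toFinite _)

theorem findim_op_eq_one_iff_of_ncard_eq (h : B.lastArrows.ncard = B.firstArrows.ncard) :
    findim Rᵐᵒᵖ = 1 ↔ B.lastArrows = B.firstArrows ∧ B.firstArrows ≠ Set.univ := by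
  have hF : B.op.firstArrows = Equiv.subLeft (-1) ⁻¹' B.lastArrows := by
    ext v
    rw [mem_op_firstArrows, Set.mem_preimage, Equiv.subLeft_apply, neg_sub_comm]
  have hL : B.op.lastArrows = Equiv.subLeft (-1) ⁻¹' B.firstArrows := by
    ext v
    rw [mem_op_lastArrows, Set.mem_preimage, Equiv.subLeft_apply, neg_sub_comm]
  have hsurj : Function.Surjective (Equiv.subLeft (-1 : ZMod n)) := Equiv.surjective _
  rw [B.op.findim_eq_one_iff_of_ncard_eq, hF, hL, hsurj.preimage_injective.eq_iff]
  · rw [eq_comm]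
    refine and_congr_right fun h => not_congr ?_
    rw [h, Set.preimage_eq_univ_iff, hsurj.range_eq, Set.univ_subset_iff]
  · rw [hF, hL, Set.ncard_preimage_of_injective_subset_range,
      Set.ncard_preimage_of_injective_subset_range, h]
    all_goals simp [Equiv.injective, hsurj.range_eq]

end

/-! ### Self-injectivity when every arrow is a first arrow -/

section

variable {K : Type*} {R : Type u} [Field K] [Ring R] [Algebra K R] {n : ℕ} [NeZero n]
  (B : PathBasis K R n)

theorem path_eq_zero_of_le {v : ZMod n} {l m : ℕ} (h : B.path v l = 0) (hlm : l ≤ m) :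
    B.path v m = 0 := by
  obtain ⟨k, rfl⟩ := Nat.exists_eq_add_of_le hlm
  rw [← B.arrowSum_pow_mul_path, h, mul_zero]

/-- If every arrow starts a minimal zero path, then all indecomposable projective modules have the
same length. -/
theorem exists_path_eq_zero_iff (hF : B.firstArrows = Set.univ) :
    ∃ c : ℕ, ∀ v l, B.path v l = 0 ↔ c ≤ l := by
  obtain ⟨N, hN⟩ := B.exists_path_eq_zero
  have hex (v : ZMod n) : ∃ l, B.path v l = 0 := ⟨N, hN v N le_rfl⟩
  choose c hc using fun v => show ∃ c, ∀ l, B.path v l = 0 ↔ c ≤ l by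
    classical
    exact ⟨Nat.find (hex v), fun l => ⟨fun h => Nat.find_min' _ h,
      fun h => B.path_eq_zero_of_le (Nat.find_spec (hex v)) h⟩⟩
  -- The lengths do not decrease along an arrow; going around the cycle, they must be constant.
  have hstep (v : ZMod n) : c v ≤ c (v + 1) := by
    obtain ⟨l, hl, hl'⟩ : v ∈ B.firstArrows := hF ▸ Set.mem_univ v
    rw [ne_eq, hc, not_le] at hl
    rw [hc] at hl'
    omega
  have hadd (v : ZMod n) (k : ℕ) : c v ≤ c (v + k) := by
    induction k with
    | zero => simp
    | succ k ih =>
      rw [Nat.cast_succ, ← add_assoc]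
      exact ih.trans (hstep _)
  have hle (v w : ZMod n) : c v ≤ c w := by
    simpa using hadd v (w - v).val
  exact ⟨c 0, fun v l => by rw [hc, (hle v 0).antisymm (hle 0 v)]⟩

theorem finite_module (B : PathBasis K R n) : Module.Finite K R := by
  obtain ⟨N, hN⟩ := B.exists_path_eq_zero
  refine Module.finite_def.2 (B.span_eq_top ▸ Submodule.fg_span ?_)
  refine (((Set.finite_univ (α := ZMod n)).prod (Set.finite_Iio N)).image
    (fun p => B.path p.1 p.2)).insert 0 |>.subset ?_
  rintro _ ⟨⟨v, l⟩, rfl⟩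
  by_cases h : N ≤ l
  · exact Or.inl (hN v l h)
  · exact Or.inr ⟨(v, l), ⟨trivial, not_le.1 h⟩, rfl⟩

/-- A finite-dimensional algebra with a linear form whose kernel contains no nonzero left ideal is
self-injective. -/
theorem _root_.SelfInjective.of_linearForm [Module.Finite K R] (t : R →ₗ[K] K)
    (ht : ∀ a : R, (∀ r, t (r * a) = 0) → a = 0) : SelfInjective R := by
  refine Module.Baer.injective fun I g => ?_
  let Φ : R →ₗ[K] Module.Dual K R :=
    { toFun := fun a => t ∘ₗ LinearMap.mulRight K a
      map_add' := fun a b => by ext; simp [mul_add]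
      map_smul' := fun c a => by ext; simp }
  have hinj : Function.Injective Φ := by
    rw [← LinearMap.ker_eq_bot, LinearMap.ker_eq_bot']
    exact fun a ha => ht a fun r => LinearMap.congr_fun ha r
  have hsurj : Function.Surjective Φ :=
    (LinearMap.injective_iff_surjective_of_finrank_eq_finrank
      (Subspace.dual_finrank_eq (K := K) (V := R)).symm).1 hinj
  -- By a dimension count every linear form is `r ↦ t (r * a)` for some `a`. Applied to an extension
  -- of `t ∘ g`, this produces the element `a` such that `g` is right multiplication by `a`.
  let φ : (I.restrictScalars K : Submodule K R) →ₗ[K] K := t ∘ₗ g.restrictScalars K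
  obtain ⟨ψ, hψ⟩ := LinearMap.exists_extend φ
  obtain ⟨a, ha⟩ := hsurj ψ
  have key (x : I) : t (g x) = t (x * a) :=
    (LinearMap.congr_fun hψ x).symm.trans (LinearMap.congr_fun ha (x : R)).symm
  refine ⟨LinearMap.toSpanSingleton R R a, fun x hx => ?_⟩
  refine (sub_eq_zero.1 (ht _ fun r => ?_)).symm
  have := key (r • ⟨x, hx⟩)
  rw [map_smul] at this
  simpa [mul_sub, sub_eq_zero, mul_assoc] using this

theorem selfInjective_of_firstArrows_eq_univ (hF : B.firstArrows = Set.univ) :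
    SelfInjective R := by
  obtain ⟨c, hc⟩ := B.exists_path_eq_zero_iff hF
  have hc0 : 1 < c := not_le.1 fun h => B.path_one_ne_zero 0 ((hc 0 1).2 h)
  have := B.finite_module
  -- The Frobenius form: all longest nonzero paths have `c - 1` arrows, and any coefficient of `a`
  -- is `t` of the product of `a` with the path completing it to that length.
  let t : R →ₗ[K] K := ∑ v, B.coeff v (c - 1)
  have ht (w : ZMod n) (m : ℕ) : t (B.path w m) = if m = c - 1 then 1 else 0 := by
    have (v : ZMod n) : B.coeff v (c - 1) (B.path w m) = if w = v ∧ m = c - 1 then 1 else 0 :=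
      B.coeff_path _ _ _ _ (by rw [ne_eq, hc]; omega)
    simp only [t, LinearMap.sum_apply, this, ite_and, Finset.sum_ite_eq, Finset.mem_univ, if_true]
  refine SelfInjective.of_linearForm t fun a ha => B.eq_zero_of_coeff_eq_zero fun v l hp => ?_
  have hl : l < c := by rwa [ne_eq, hc, not_le] at hp
  have : B.coeff v l = t ∘ₗ LinearMap.mulLeft K (B.path (v + l) (c - 1 - l)) := by
    refine B.linearMap_ext fun w m => ?_
    rw [LinearMap.comp_apply, LinearMap.mulLeft_apply, B.path_mul_path, B.coeff_path _ _ _ _ hp]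
    by_cases hm : m = l
    · subst hm
      simp only [add_left_inj, and_true, eq_comm (a := w)]
      split_ifs with h
      · rw [ht, if_pos (by omega)]
      · rw [map_zero]
    · rw [if_neg fun h => hm h.2]
      split_ifs with h
      · rw [ht, if_neg (by omega)]
      · rw [map_zero]
  rw [this]
  exact ha _

end

end PathBasis

/-! ### Tops of cyclic modules -/

namespace PathBasis

variable {K R : Type*} [Field K] [Ring R] [Algebra K R] {n : ℕ} [NeZero n] (B : PathBasis K R n)

theorem path_zero_ne_zero (v : ZMod n) : B.path v 0 ≠ 0 := fun h =>
  B.path_one_ne_zero v (by rw [← zero_add 1, ← B.arrowSum_mul_path, h, mul_zero])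

/-- This coefficient is the character through which R acts on the simple module S_w. -/
theorem coeff_zero_mul (w : ZMod n) (x y : R) :
    B.coeff w 0 (x * y) = B.coeff w 0 x * B.coeff w 0 y := by
  induction x using B.induction with
  | hadd a b ha hb => rw [add_mul, map_add, map_add, add_mul, ha, hb]
  | hpath c v l =>
  induction y using B.induction with
  | hadd a b ha hb => rw [mul_add, map_add, map_add, mul_add, ha, hb]
  | hpath d u m =>
  have hw := B.path_zero_ne_zero w
  have key : B.coeff w 0 (B.path v l * B.path u m) =
      B.coeff w 0 (B.path v l) * B.coeff w 0 (B.path u m) := by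
    rw [B.path_mul_path, B.coeff_path _ _ _ _ hw, B.coeff_path _ _ _ _ hw]
    by_cases h : v = u + m
    · subst h
      rw [if_pos rfl, B.coeff_path _ _ _ _ hw, ite_zero_mul_ite_zero, mul_one]
      congr 1
      rw [eq_iff_iff]
      constructor
      · rintro ⟨rfl, hm⟩
        obtain ⟨rfl, rfl⟩ := Nat.add_eq_zero_iff.1 hm
        simp
      · rintro ⟨⟨-, rfl⟩, h, rfl⟩
        exact ⟨h, rfl⟩
    · rw [if_neg h, map_zero, ite_zero_mul_ite_zero, if_neg]
      rintro ⟨⟨rfl, rfl⟩, rfl, rfl⟩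
      simp at h
  rw [smul_mul_smul_comm, map_smul, map_smul, map_smul, key]
  simp only [smul_eq_mul]
  ring

theorem coeff_zero_one (w : ZMod n) : B.coeff w 0 1 = 1 := by
  have h1 : B.coeff w 0 (B.path w 0) = 1 := by
    rw [B.coeff_path _ _ _ _ (B.path_zero_ne_zero w), if_pos ⟨rfl, rfl⟩]
  have h2 := B.coeff_zero_mul w 1 (B.path w 0)
  rwa [one_mul, h1, mul_one, eq_comm] at h2

/-- The top of a quotient of `Λ e_v` determines the vertex `v`. -/
theorem eq_of_linearEquiv {v w : ZMod n} {d d' : ℕ} (hd : d' ≠ 0)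
    (φ : (R ⧸ (Ideal.span {1 - B.path v 0, B.path v d} : Ideal R)) ≃ₗ[R]
      (R ⧸ (Ideal.span {1 - B.path w 0, B.path w d'} : Ideal R))) : v = w := by
  by_contra hvw
  set I : Ideal R := Ideal.span {1 - B.path v 0, B.path v d}
  set J : Ideal R := Ideal.span {1 - B.path w 0, B.path w d'}
  have hw := B.path_zero_ne_zero w
  obtain ⟨y, hy⟩ := Submodule.mkQ_surjective J (φ (I.mkQ 1))
  obtain ⟨z, hz⟩ := Submodule.mkQ_surjective I (φ.symm (J.mkQ 1))
  have h1 : I.mkQ 1 = B.path v 0 • I.mkQ 1 := by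
    rw [← map_smul, ← sub_eq_zero, ← map_sub, smul_eq_mul, mul_one]
    exact (Submodule.Quotient.mk_eq_zero _).2 (Ideal.subset_span (by simp))
  -- Modulo `J` the unit factors through the idempotent at `v`. The character at `w ≠ v` kills that
  -- idempotent and, as `d' ≠ 0`, also `J`, which yields `0 = 1`.
  have h2 : J.mkQ (z * (B.path v 0 * y)) = J.mkQ 1 := by
    rw [← smul_eq_mul, ← smul_eq_mul, map_smul, map_smul, hy, ← map_smul, ← h1, ← map_smul,
      ← map_smul, smul_eq_mul, mul_one, hz, LinearEquiv.apply_symm_apply]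
  rw [← sub_eq_zero, ← map_sub] at h2
  obtain ⟨a, b, hab⟩ := Ideal.mem_span_pair.1 ((Submodule.Quotient.mk_eq_zero _).1 h2)
  have h3 := congrArg (B.coeff w 0) hab
  simp only [map_add, map_sub, B.coeff_zero_mul, B.coeff_zero_one, B.coeff_path _ _ _ _ hw, hvw, hd]
    at h3
  simp at h3

end PathBasis

namespace CyclicPathAlgebra

variable {K : Type u} [Field K] {n : ℕ}

theorem path_mul_path_of_eq {p q : CyclicPath n} (h : p.source = q.target) :
    path K p * path K q = path K (p.comp q) := by
  rw [path_mul_path, pathMul, if_pos h]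

theorem path_mul_path_of_ne {p q : CyclicPath n} (h : p.source ≠ q.target) :
    path K p * path K q = 0 := by
  rw [path_mul_path, pathMul, if_neg h]

end CyclicPathAlgebra

namespace IrredundantSystem

variable {n : ℕ}

theorem steps_pos (a b : ZMod n) : 0 < steps a b := Nat.succ_pos _

theorem steps_eq {a b : ZMod n} {s : ℕ} (h0 : 0 < s) (hs : s ≤ n) (h : a + s = b) :
    steps a b = s := by
  obtain ⟨s, rfl⟩ := Nat.exists_eq_succ_of_ne_zero h0.ne'
  have : b - a - 1 = (s : ℕ) := by rw [← h]; push_cast; ring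
  rw [steps, this, ZMod.val_natCast_of_lt (by omega)]

end IrredundantSystem

/-! ### The basis of Λ by paths that contain no relation -/

namespace IrredundantSystem

section

variable {K : Type u} [Field K] {n r : ℕ} [NeZero n] [NeZero r] (S : IrredundantSystem K n r)

open CyclicPathAlgebra

/-- A path contains one of the relations. -/
def ContainsRelation (p : CyclicPath n) : Prop :=
  ∃ j, ∃ t : ℕ, p.source + t = S.first j ∧ t + S.length j ≤ p.length

theorem path_mem_of_subpath {I : TwoSidedIdeal (CyclicPathAlgebra K n)} {p q : CyclicPath n}
    (hq : path K q ∈ I) {t : ℕ} (ht : p.source + t = q.source) (hl : t + q.length ≤ p.length) :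
    path K p ∈ I := by
  obtain ⟨s, hs⟩ := Nat.exists_eq_add_of_le hl
  have h : path K p = path K ⟨q.source + (q.length : ZMod n), s⟩ * path K q * path K ⟨p.source, t⟩ := by
    rw [path_mul_path_of_eq rfl, path_mul_path_of_eq ht.symm]
    congr 1
    ext
    · rfl
    · simp only [CyclicPath.comp, hs]
      ring
  rw [h]
  exact I.mul_mem_right _ _ (I.mul_mem_left _ _ hq)

/-- Irredundance in numerical form: otherwise relation `i` would be a subpath of relation `j`. -/
theorem length_lt {i j : Fin r} (hij : i ≠ j) {t : ℕ} (ht : S.first j + t = S.first i) :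
    S.length j < t + S.length i := by
  by_contra h
  refine S.irredundant j (path_mem_of_subpath (q := ⟨S.first i, S.length i⟩) ?_ ht (not_lt.1 h))
  exact TwoSidedIdeal.subset_span ⟨i, hij, rfl⟩

theorem path_mem_relationIdeal {p : CyclicPath n} (hp : S.ContainsRelation p) :
    path K p ∈ S.relationIdeal := by
  obtain ⟨j, t, ht, hl⟩ := hp
  exact path_mem_of_subpath (q := ⟨S.first j, S.length j⟩)
    (TwoSidedIdeal.subset_span ⟨j, rfl⟩) ht hl

theorem ContainsRelation.comp_left {S : IrredundantSystem K n r} {p q : CyclicPath n}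
    (hq : S.ContainsRelation q) : S.ContainsRelation (p.comp q) := by
  obtain ⟨j, t, ht, hl⟩ := hq
  exact ⟨j, t, ht, hl.trans (Nat.le_add_right _ _)⟩

theorem ContainsRelation.comp_right {S : IrredundantSystem K n r} {p q : CyclicPath n}
    (hp : S.ContainsRelation p) (h : p.source = q.target) : S.ContainsRelation (p.comp q) := by
  obtain ⟨j, t, ht, hl⟩ := hp
  refine ⟨j, q.length + t, ?_, ?_⟩
  · rw [← ht, h, CyclicPath.target, CyclicPath.comp]
    push_cast
    ring
  · rw [add_assoc]
    exact Nat.add_le_add_left hl _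

/-- The span of the paths that contain a relation. -/
noncomputable def relationSpan : Submodule K (CyclicPathAlgebra K n) :=
  Submodule.span K (path K '' {p | S.ContainsRelation p})

theorem mul_mem_relationSpan {x y : CyclicPathAlgebra K n} (h : x ∈ S.relationSpan) :
    x * y ∈ S.relationSpan := by
  induction h using Submodule.span_induction with
  | zero => rw [zero_mul]; exact zero_mem _
  | add a b _ _ ha hb => rw [add_mul]; exact add_mem ha hb
  | smul c a _ ha => rw [smul_mul_assoc]; exact Submodule.smul_mem _ _ ha
  | mem a ha =>
    obtain ⟨p, hp, rfl⟩ := ha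
    induction y using CyclicPathAlgebra.induction with
    | h0 => rw [mul_zero]; exact zero_mem _
    | hadd a b ha hb => rw [mul_add]; exact add_mem ha hb
    | hpath c q =>
      rw [mul_smul_comm, path_mul_path, pathMul]
      refine Submodule.smul_mem _ _ ?_
      split_ifs with h
      · exact Submodule.subset_span ⟨_, hp.comp_right h, rfl⟩
      · exact zero_mem _

theorem mul_mem_relationSpan' {x y : CyclicPathAlgebra K n} (h : y ∈ S.relationSpan) :
    x * y ∈ S.relationSpan := by
  induction h using Submodule.span_induction with
  | zero => rw [mul_zero]; exact zero_mem _
  | add a b _ _ ha hb => rw [mul_add]; exact add_mem ha hb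
  | smul c a _ ha => rw [mul_smul_comm]; exact Submodule.smul_mem _ _ ha
  | mem a ha =>
    obtain ⟨p, hp, rfl⟩ := ha
    induction x using CyclicPathAlgebra.induction with
    | h0 => rw [zero_mul]; exact zero_mem _
    | hadd a b ha hb => rw [add_mul]; exact add_mem ha hb
    | hpath c q =>
      rw [smul_mul_assoc, path_mul_path, pathMul]
      refine Submodule.smul_mem _ _ ?_
      split_ifs with h
      · exact Submodule.subset_span ⟨_, ContainsRelation.comp_left hp, rfl⟩
      · exact zero_mem _

/-- The span is itself a two-sided ideal containing the relations. So coordinates at relation-free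
paths vanish on the relation ideal and descend to Λ. -/
theorem mem_relationSpan {x : CyclicPathAlgebra K n} (hx : x ∈ S.relationIdeal) :
    x ∈ S.relationSpan := by
  let I : TwoSidedIdeal (CyclicPathAlgebra K n) := .mk' S.relationSpan (zero_mem _)
    (fun hx hy => add_mem hx hy) (fun hx => neg_mem hx) (fun hy => S.mul_mem_relationSpan' hy)
    (fun hx => S.mul_mem_relationSpan hx)
  have hI : ∀ y, y ∈ I ↔ y ∈ S.relationSpan := TwoSidedIdeal.mem_mk' _ _ _ _ _ _
  rw [← hI]
  refine TwoSidedIdeal.mem_span_iff.1 hx I ?_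
  rintro _ ⟨j, rfl⟩
  exact (hI _).2 (Submodule.subset_span ⟨_, ⟨j, 0, by simp, by simp⟩, rfl⟩)

/-- The projection from the path algebra to `Λ`, as a linear map. -/
noncomputable def projection : CyclicPathAlgebra K n →ₗ[K] S.Nakayama where
  toFun := S.relationIdeal.ringCon.mk'
  map_add' := map_add _
  map_smul' _ _ := rfl

theorem projection_path (p : CyclicPath n) : S.projection (path K p) = S.pathClass p := rfl

theorem projection_surjective : Function.Surjective S.projection :=
  RingCon.mk'_surjective _

theorem projection_eq_zero_iff {x : CyclicPathAlgebra K n} :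
    S.projection x = 0 ↔ x ∈ S.relationIdeal := by
  rw [TwoSidedIdeal.mem_iff]
  exact RingCon.eq _

open scoped Classical in
theorem exists_coefficient (p : CyclicPath n) : ∃ f : S.Nakayama →ₗ[K] K,
    ¬ S.ContainsRelation p → ∀ q, f (S.pathClass q) = if q = p then 1 else 0 := by
  by_cases hp : S.ContainsRelation p
  · exact ⟨0, fun h => absurd hp h⟩
  let c : CyclicPathAlgebra K n →ₗ[K] K := (Finsupp.lapply p : (CyclicPath n →₀ K) →ₗ[K] K)
  have hc (q : CyclicPath n) : c (path K q) = if q = p then 1 else 0 := Finsupp.single_apply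
  have hker : LinearMap.ker S.projection ≤ LinearMap.ker c := by
    intro x hx
    have hspan : S.relationSpan ≤ LinearMap.ker c := by
      rw [relationSpan, Submodule.span_le]
      rintro _ ⟨q, hq, rfl⟩
      rw [SetLike.mem_coe, LinearMap.mem_ker, hc, if_neg]
      rintro rfl
      exact hp hq
    exact hspan (S.mem_relationSpan (S.projection_eq_zero_iff.1 hx))
  refine ⟨(LinearMap.ker S.projection).liftQ c hker ∘ₗ
    (S.projection.quotKerEquivOfSurjective S.projection_surjective).symm.toLinearMap,
    fun _ q => ?_⟩
  have hq : (S.projection.quotKerEquivOfSurjective S.projection_surjective).symm (S.pathClass q) =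
      (LinearMap.ker S.projection).mkQ (path K q) := by
    rw [LinearEquiv.symm_apply_eq]
    rfl
  rw [LinearMap.comp_apply, LinearEquiv.coe_coe, hq]
  exact hc q

theorem pathClass_eq_zero_iff {p : CyclicPath n} :
    S.pathClass p = 0 ↔ S.ContainsRelation p := by
  constructor
  · intro h
    by_contra hp
    obtain ⟨f, hf⟩ := S.exists_coefficient p
    have := hf hp p
    rw [h, map_zero, if_pos rfl] at this
    exact zero_ne_one this
  · intro h
    exact S.projection_eq_zero_iff.2 (S.path_mem_relationIdeal h)

/-- The basis of `Λ` that consists of the paths containing no relation. -/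
noncomputable def pathBasis : PathBasis K S.Nakayama n where
  path v l := S.pathClass ⟨v, l⟩
  path_mul_path v l w m := by
    rw [pathClass, pathClass, ← map_mul]
    by_cases h : v = w + m
    · rw [if_pos h, path_mul_path_of_eq h]
      rfl
    · rw [if_neg h, path_mul_path_of_ne h, map_zero]
  sum_path_zero := by
    rw [← map_one S.relationIdeal.ringCon.mk', one_eq, map_sum]
    rfl
  exists_path_eq_zero := by
    -- From any source fewer than `n` arrows lead to the start of relation 0, and `length 0` further
    -- arrows complete it.
    refine ⟨n + S.length 0, fun v l h => S.pathClass_eq_zero_iff.2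
      ⟨0, (S.first 0 - v).val, by simp, le_trans ?_ h⟩⟩
    exact Nat.add_le_add_right (ZMod.val_lt _).le _
  path_one_ne_zero v h := by
    obtain ⟨j, t, -, hl⟩ := S.pathClass_eq_zero_iff.1 h
    have := S.two_le_length j
    simp only at hl
    omega
  coeff v l := (S.exists_coefficient ⟨v, l⟩).choose
  coeff_path v l w m h := by
    rw [(S.exists_coefficient ⟨v, l⟩).choose_spec fun h' => h (S.pathClass_eq_zero_iff.2 h')]
    simp only [CyclicPath.mk.injEq]
  span_eq_top := by
    rw [eq_top_iff]
    rintro x -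
    obtain ⟨x, rfl⟩ := S.projection_surjective x
    induction x using CyclicPathAlgebra.induction with
    | h0 => rw [map_zero]; exact zero_mem _
    | hadd a b ha hb => rw [map_add]; exact add_mem ha hb
    | hpath c p =>
      rw [map_smul, projection_path]
      exact Submodule.smul_mem _ _ (Submodule.subset_span ⟨(p.source, p.length), rfl⟩)

theorem pathBasis_path (v : ZMod n) (l : ℕ) : S.pathBasis.path v l = S.pathClass ⟨v, l⟩ := rfl

theorem first_injective : Function.Injective S.first := by
  obtain ⟨c, hc⟩ := S.cyclically_ordered
  intro i j h
  have := hc.injective (a₁ := i - c) (a₂ := j - c) (by simp [h])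
  simpa using this

theorem firstArrows_pathBasis : S.pathBasis.firstArrows = Set.range S.first := by
  ext v
  constructor
  · rintro ⟨l, hl, hl'⟩
    rw [ne_eq, pathBasis_path, pathClass_eq_zero_iff] at hl
    rw [pathBasis_path, pathClass_eq_zero_iff] at hl'
    obtain ⟨j, t, ht, htl⟩ := hl'
    -- A relation that skips the first arrow would already lie in the shorter path, which is
    -- nonzero.
    cases t with
    | zero => exact ⟨j, by simpa using ht.symm⟩
    | succ t =>
      refine absurd ⟨j, t, ?_, ?_⟩ hl
      · rw [← ht]; push_cast; ring
      · simp only at htl ⊢; omega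
  · rintro ⟨j, rfl⟩
    have h2 := S.two_le_length j
    refine ⟨S.length j - 1, ?_, ?_⟩
    · rw [ne_eq, pathBasis_path, pathClass_eq_zero_iff]
      rintro ⟨i, t, ht, hl⟩
      simp only at ht hl
      by_cases hij : i = j
      · subst hij; omega
      · have := S.length_lt hij (t := t + 1) (by rw [← ht]; push_cast; ring)
        omega
    · rw [pathBasis_path, pathClass_eq_zero_iff]
      exact ⟨j, 0, by simp, by simp only; omega⟩

theorem lastArrows_pathBasis : S.pathBasis.lastArrows = Set.range S.last := by
  ext v
  constructor
  · rintro ⟨w, l, rfl, hl, hl'⟩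
    rw [ne_eq, pathBasis_path, pathClass_eq_zero_iff] at hl
    rw [pathBasis_path, pathClass_eq_zero_iff] at hl'
    obtain ⟨j, t, ht, htl⟩ := hl'
    have h : t + S.length j = l + 1 := by
      by_contra h
      exact hl ⟨j, t, ht, by simp only at htl ⊢; omega⟩
    refine ⟨j, ?_⟩
    have h' := congrArg (Nat.cast (R := ZMod n)) h
    push_cast at h'
    simp only at ht
    rw [last, ← ht]
    linear_combination h'
  · rintro ⟨j, rfl⟩
    have h2 := S.two_le_length j
    refine ⟨S.first j, S.length j - 1, ?_, ?_, ?_⟩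
    · rw [last, Nat.cast_sub (by omega), Nat.cast_one, add_sub_assoc]
    · rw [ne_eq, pathBasis_path, pathClass_eq_zero_iff]
      rintro ⟨i, t, ht, hl⟩
      simp only at ht hl
      by_cases hij : i = j
      · subst hij; omega
      · have := S.length_lt hij ht
        omega
    · rw [pathBasis_path, pathClass_eq_zero_iff]
      exact ⟨j, 0, by simp, by simp only; omega⟩

/-! ### The cyclic order of the first and last arrows, and the two sets of modules -/

theorem steps_le (a b : ZMod n) : steps a b ≤ n := ZMod.val_lt _

theorem add_steps (a b : ZMod n) : a + (steps a b : ℕ) = b := by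
  rw [steps]
  push_cast
  rw [ZMod.natCast_zmod_val]
  ring

theorem steps_injective {a b c : ZMod n} (h : steps a b = steps a c) : b = c := by
  rw [← add_steps a b, h, add_steps]

theorem steps_eq_val (a b : ZMod n) :
    steps a b = if a.val < b.val then b.val - a.val else b.val + n - a.val := by
  have ha := ZMod.val_lt a
  have hb := ZMod.val_lt b
  split_ifs with h
  · refine steps_eq (by omega) (by omega) ?_
    rw [Nat.cast_sub h.le, ZMod.natCast_zmod_val, ZMod.natCast_zmod_val]
    ring
  · refine steps_eq (by omega) (by omega) ?_
    rw [Nat.cast_sub (by omega), Nat.cast_add, ZMod.natCast_zmod_val, ZMod.natCast_zmod_val,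
      ZMod.natCast_self]
    ring

theorem steps_self (a : ZMod n) : steps a a = n := by
  simp [steps_eq_val]

/-- The vertex `first (j + 1)` is the first one that one meets after `first j`. -/
theorem steps_first_succ_le (j i : Fin r) :
    steps (S.first j) (S.first (j + 1)) ≤ steps (S.first j) (S.first i) := by
  obtain ⟨c, hc⟩ := S.cyclically_ordered
  obtain ⟨j, rfl⟩ : ∃ k, j = k + c := ⟨j - c, by simp⟩
  obtain ⟨i, rfl⟩ : ∃ k, i = k + c := ⟨i - c, by simp⟩
  rw [add_right_comm]
  have hlt {a b : Fin r} : a < b ↔ (S.first (a + c)).val < (S.first (b + c)).val :=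
    (hc.lt_iff_lt (a := a) (b := b)).symm
  have hle {a b : Fin r} : a ≤ b ↔ (S.first (a + c)).val ≤ (S.first (b + c)).val :=
    (hc.le_iff_le (a := a) (b := b)).symm
  have hi := ZMod.val_lt (S.first (i + c))
  have hj := ZMod.val_lt (S.first (j + c))
  have hj' := ZMod.val_lt (S.first (j + 1 + c))
  simp only [steps_eq_val, ← hlt]
  -- In the second case `j` is the final index and `j + 1` wraps around to 0.
  by_cases hr : j.val + 1 < r
  · have h1 : (j + 1).val = j.val + 1 := Fin.val_add_one_of_lt' hr
    have hjj : j < j + 1 := Fin.lt_def.2 (by omega)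
    rw [if_pos hjj]
    have h3 := hlt.1 hjj
    split_ifs with h
    · have h2 : j + 1 ≤ i := Fin.le_def.2 (by have := Fin.lt_def.1 h; omega)
      have := hle.1 h2
      omega
    · omega
  · have h1 : (j + 1).val = 0 := by
      have : j.val + 1 = r := by have := j.isLt; omega
      rw [Fin.val_add, Fin.val_one', Nat.add_mod_mod, this, Nat.mod_self]
    have hjj : ¬ j < j + 1 := fun h => by have := Fin.lt_def.1 h; omega
    have hji : ¬ j < i := fun h => by have := Fin.lt_def.1 h; have := i.isLt; omega
    rw [if_neg hjj, if_neg hji]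
    have := hle.1 (show j + 1 ≤ i from Fin.le_def.2 (by omega))
    omega

/-- Modulo `n` this is immediate. It holds for integers because irredundance, used in both
directions, keeps the shifted distance strictly between 0 and `n` when `i ≠ j`. -/
theorem steps_last (j i : Fin r) : steps (S.last j) (S.last i) + S.length j =
    steps (S.first j) (S.first i) + S.length i := by
  by_cases hij : i = j
  · subst hij; rw [steps_self, steps_self]
  have h1 := S.length_lt hij (add_steps (S.first j) (S.first i))
  have h2 := S.length_lt (Ne.symm hij) (add_steps (S.first i) (S.first j))
  have hne : S.first i ≠ S.first j := fun h => hij (S.first_injective h)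
  have h3 : steps (S.first j) (S.first i) + steps (S.first i) (S.first j) = n := by
    have ha := ZMod.val_lt (S.first i)
    have hb := ZMod.val_lt (S.first j)
    have hv : (S.first i).val ≠ (S.first j).val := fun h => hne (ZMod.val_injective n h)
    rw [steps_eq_val, steps_eq_val]
    split_ifs <;> omega
  rw [steps_eq (s := steps (S.first j) (S.first i) + S.length i - S.length j) (by omega) (by omega)]
  · omega
  · rw [Nat.cast_sub (by omega), Nat.cast_add, last, last]
    linear_combination add_steps (S.first j) (S.first i)

/-- If two last arrows agreed, `steps_last` in both directions would make the two distances between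
the distinct first arrows add up to `2 n`, although each is less than `n`. -/
theorem last_injective : Function.Injective S.last := by
  intro j i h
  by_contra hij
  have h1 := S.steps_last j i
  have h2 := S.length_lt hij (add_steps (S.first i) (S.first j))
  have h3 := steps_le (S.first j) (S.first i)
  have h4 := S.length_lt (Ne.symm hij) (add_steps (S.first j) (S.first i))
  have h5 := S.steps_last i j
  rw [h, steps_self] at h1
  rw [h, steps_self] at h5
  have h6 := steps_le (S.first i) (S.first j)
  have hne : (S.first j).val ≠ (S.first i).val := fun h =>
    hij (S.first_injective (ZMod.val_injective n h))
  have ha := ZMod.val_lt (S.first i)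
  have hb := ZMod.val_lt (S.first j)
  have h7 : steps (S.first j) (S.first i) < n := by
    rw [steps_eq_val]; split_ifs <;> omega
  have h8 : steps (S.first i) (S.first j) < n := by
    rw [steps_eq_val]; split_ifs <;> omega
  omega

/-- The vertex `last (j + 1)` is the first one that one meets after `last j`. -/
theorem steps_last_succ_le (j i : Fin r) :
    steps (S.last j) (S.last (j + 1)) ≤ steps (S.last j) (S.last i) := by
  by_cases hi : i = j
  · subst hi; rw [steps_self]; exact steps_le _ _
  by_cases hi' : i = j + 1
  · rw [hi']
  have h1 := S.steps_last j (j + 1)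
  have h2 := S.steps_last j i
  have h3 := S.steps_first_succ_le j i
  -- Relation `i` starts this many arrows after relation `j + 1`, so irredundance forces it to end
  -- later as well.
  have h4 : S.first (j + 1) +
      ((steps (S.first j) (S.first i) - steps (S.first j) (S.first (j + 1)) : ℕ) : ZMod n) =
      S.first i := by
    rw [Nat.cast_sub h3]
    linear_combination add_steps (S.first j) (S.first i) -
      add_steps (S.first j) (S.first (j + 1))
  have h5 := S.length_lt hi' h4
  omega

/-- The successor is the nearest element in the cyclic order, so it depends only on the underlying
set and not on the numbering. -/
theorem eq_succ_of_range_eq {x y : Fin r → ZMod n} (hxy : Set.range x = Set.range y)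
    (hx : ∀ j i, steps (x j) (x (j + 1)) ≤ steps (x j) (x i))
    (hy : ∀ j i, steps (y j) (y (j + 1)) ≤ steps (y j) (y i)) {i j : Fin r} (h : x i = y j) :
    x (i + 1) = y (j + 1) := by
  obtain ⟨k, hk⟩ : x (i + 1) ∈ Set.range y := hxy ▸ Set.mem_range_self _
  obtain ⟨l, hl⟩ : y (j + 1) ∈ Set.range x := hxy ▸ Set.mem_range_self _
  refine steps_injective (a := x i) (le_antisymm ?_ ?_)
  · rw [← hl]; exact hx i l
  · rw [h, ← hk]; exact hy j k

theorem baseSet_subset_nablaSet_of_range_eq (h : Set.range S.first = Set.range S.last) :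
    S.baseSet ⊆ S.nablaSet := by
  rintro M ⟨j, hM⟩
  obtain ⟨i, hi⟩ : S.last j ∈ Set.range S.first := h ▸ Set.mem_range_self _
  refine ⟨i, ?_⟩
  rwa [hi, eq_succ_of_range_eq h S.steps_first_succ_le S.steps_last_succ_le hi]

theorem nablaSet_subset_baseSet_of_range_eq (h : Set.range S.first = Set.range S.last) :
    S.nablaSet ⊆ S.baseSet := by
  rintro M ⟨j, hM⟩
  obtain ⟨i, hi⟩ : S.first j ∈ Set.range S.last := h ▸ Set.mem_range_self _
  refine ⟨i, ?_⟩
  rwa [hi, eq_succ_of_range_eq h.symm S.steps_last_succ_le S.steps_first_succ_le hi]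

theorem eq_of_interval_equiv {a b c d : ZMod n}
    (φ : S.interval a b ≃ₗ[S.Nakayama] S.interval c d) : a = c :=
  add_right_cancel (S.pathBasis.eq_of_linearEquiv (steps_pos c d).ne' φ)

/-- The tops alone decide: they are the vertices following the last arrows for one set and the first
arrows for the other. -/
theorem range_eq_of_baseSet_eq_nablaSet (h : S.baseSet = S.nablaSet) :
    Set.range S.first = Set.range S.last := by
  apply Set.Subset.antisymm
  · rintro _ ⟨j, rfl⟩
    have hj : ModuleCat.of S.Nakayama (S.interval (S.first j) (S.first (j + 1))) ∈ S.nablaSet :=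
      ⟨j, ⟨LinearEquiv.refl _ _⟩⟩
    rw [← h] at hj
    obtain ⟨i, ⟨φ⟩⟩ := hj
    exact ⟨i, (S.eq_of_interval_equiv φ).symm⟩
  · rintro _ ⟨j, rfl⟩
    have hj : ModuleCat.of S.Nakayama (S.interval (S.last j) (S.last (j + 1))) ∈ S.baseSet :=
      ⟨j, ⟨LinearEquiv.refl _ _⟩⟩
    rw [h] at hj
    obtain ⟨i, ⟨φ⟩⟩ := hj
    exact ⟨i, (S.eq_of_interval_equiv φ).symm⟩

theorem ncard_lastArrows_eq :
    S.pathBasis.lastArrows.ncard = S.pathBasis.firstArrows.ncard := by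
  rw [lastArrows_pathBasis, firstArrows_pathBasis, ← Set.image_univ, ← Set.image_univ,
    Set.ncard_image_of_injective _ S.last_injective,
    Set.ncard_image_of_injective _ S.first_injective]

end

end IrredundantSystem

theorem proposition3p2 {K : Type u} [Field K] {n r : ℕ} [NeZero n] [NeZero r]
    (S : IrredundantSystem K n r) :
    (¬ SelfInjective S.Nakayama →
      [findim S.Nakayama = 1,
        Set.range S.first = Set.range S.last,
        S.baseSet = S.nablaSet].TFAE) ∧
    (findim S.Nakayama = 1 ↔ findim S.Nakayamaᵐᵒᵖ = 1) := by
  have key := S.pathBasis.findim_eq_one_iff_of_ncard_eq S.ncard_lastArrows_eq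
  constructor
  · intro hS
    -- The hypothesis enters only here; in (b) the condition that F is proper stays on both sides.
    have hF : S.pathBasis.firstArrows ≠ Set.univ := fun h =>
      hS (S.pathBasis.selfInjective_of_firstArrows_eq_univ h)
    tfae_have 1 ↔ 2 := by
      rw [key, and_iff_left hF, S.firstArrows_pathBasis, S.lastArrows_pathBasis, eq_comm]
    tfae_have 2 → 3 := fun h => (S.baseSet_subset_nablaSet_of_range_eq h).antisymm
      (S.nablaSet_subset_baseSet_of_range_eq h)
    tfae_have 3 → 2 := S.range_eq_of_baseSet_eq_nablaSet
    tfae_finish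
  · rw [key, S.pathBasis.findim_op_eq_one_iff_of_ncard_eq S.ncard_lastArrows_eq]
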